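/- **Setting.** Let $\mathbb S=\mathrm{Res}_{\mathbb C/\mathbb R}\mathbb G_m$. A Shimura datum $(G,X)$ (in the sense of Deligne) consists of a connected reductive algebraic group $G$ over $\mathbb Q$ and a $G(\mathbb R)$-conjugacy class $X$ of homomorphisms $h:\mathbb S\to G_{\mathbb R}$ such that for $h\in X$: (i) $\mathrm{Ad}\circ h$ induces on $\mathrm{Lie}(G)_{\mathbb C}$ a Hodge structure of type $\{(-1,1),(0,0),(1,-1)\}$; (ii) $\mathrm{ad}\,h(i)$ is a Cartan involution of $G^{ad}_{\mathbb R}$; (iii) $G^{ad}$ has no nontrivial factor over $\mathbb Q$ on which the projection of $h$ is trivial. Here $G^{ad}=G/Z(G)$, where $Z(G)$ is the centre of $G$. For an algebraic group $H$ over $\mathbb Q$ and a homomorphism $y:\mathbb S\to H_{\mathbb R}$, write $y^{ad}:\mathbb S\to H^{ad}_{\mathbb R}$ for its composite with $H_{\mathbb R}\to H^{ad}_{\mathbb R}$. The Mumford–Tate group of $y$ is the smallest algebraic subgroup $M_y\subseteq H$ over $\mathbb Q$ such that $y$ factors through $(M_y)_{\mathbb R}$; for $y\in X$ with $(G,X)$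 a Shimura datum, it is the group of the smallest Shimura subdatum of $(G,X)$ containing $y$. A point $x\in X_M$ of a Shimura datum $(M,X_M)$ is Hodge generic if the Mumford–Tate group of $x^{ad}$ is $M^{ad}$ (equivalently, $M_x$ contains the derived group of $M$; this holds in particular if $M_x=M$). For Shimura data $(M,X_M)$ and $(G,X)$ and a Hodge generic point $x\in X_M$, the hybrid Hecke orbit of $(M,X_M,x)$ in $X$ is $$\Sigma_X(M,X_M,x)=\{x'\in X \mid \exists\, \phi\in \mathrm{Hom}_{\mathbb Q}(M^{ad},M_{x'}^{ad}),\ \phi\circ x^{ad}=x'^{ad}\},$$ where $x'^{ad}$ denotes the composite $\mathbb S\to (M_{x'})_{\mathbb R}\to (M_{x'}^{ad})_{\mathbb R}$ induced by $x'$. **Proposition.** Let $(M,X_M)$, $(G_1,X_1)$ and $(G_2,X_2)$ be Shimura data and let $x\in X_M$ be a Hodge generic point. Then, for the datum $(G_1\times G_2,X_1\times X_2)$, where homomorphisms $\mathbb S\to (G_1\times G_2)_{\mathbb R}$ are identified with pairs of homomorphisms, $$\Sigma_{X_1\times X_2}(M,X_M,x)=\Sigma_{X_1}(M,X_M,x)\times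 \Sigma_{X_2}(M,X_M,x).$$ -/

import Mathlib

open scoped TensorProduct

universe u v w

/-!
Affine group schemes `G` over a field `k` are given by their coordinate rings: commutative Hopf
algebras `A = O(G)` over `k`. Dictionary:
* `G(R)` is `A →ₐ[k] R`, with product the convolution product on `WithConv (A →ₐ[k] R)` and
  inverse `g ↦ g ∘ antipode`;
* homomorphisms `G → H` are bialgebra homomorphisms `O(H) →ₐc[k] O(G)`;
* closed subgroups of `G` are Hopf ideals of `A` (smaller subgroups have larger ideals);
* `G₁ × G₂` is `A₁ ⊗[k] A₂`, and the base change `G_K` is `K ⊗[k] A`.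
-/

noncomputable section
namespace Shimura

/-- The polynomial `a ^ 2 + b ^ 2`. -/
def torusNorm : MvPolynomial (Fin 2) ℝ := MvPolynomial.X 0 ^ 2 + MvPolynomial.X 1 ^ 2

/-- Coordinate ring `ℝ[a, b, (a ^ 2 + b ^ 2)⁻¹]` of the Deligne torus `S = Res_{ℂ/ℝ} 𝔾ₘ`; the point
`(a, b)` is `a + b i`. -/
def DeligneTorus : Type := Localization.Away torusNorm

namespace DeligneTorus

instance : CommRing DeligneTorus := inferInstanceAs (CommRing (Localization.Away torusNorm))
instance : Algebra ℝ DeligneTorus := inferInstanceAs (Algebra ℝ (Localization.Away torusNorm))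
instance : Algebra ℚ DeligneTorus := inferInstanceAs (Algebra ℚ (Localization.Away torusNorm))
instance : IsScalarTower ℚ ℝ DeligneTorus :=
  inferInstanceAs (IsScalarTower ℚ ℝ (Localization.Away torusNorm))
instance : Algebra (MvPolynomial (Fin 2) ℝ) DeligneTorus :=
  inferInstanceAs (Algebra (MvPolynomial (Fin 2) ℝ) (Localization.Away torusNorm))
instance : IsScalarTower ℝ (MvPolynomial (Fin 2) ℝ) DeligneTorus :=
  inferInstanceAs (IsScalarTower ℝ (MvPolynomial (Fin 2) ℝ) (Localization.Away torusNorm))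
instance : IsLocalization.Away torusNorm DeligneTorus :=
  inferInstanceAs (IsLocalization.Away torusNorm (Localization.Away torusNorm))

/-- The coordinate function `a`. -/
def re : DeligneTorus := algebraMap (MvPolynomial (Fin 2) ℝ) DeligneTorus (MvPolynomial.X 0)
/-- The coordinate function `b`. -/
def im : DeligneTorus := algebraMap (MvPolynomial (Fin 2) ℝ) DeligneTorus (MvPolynomial.X 1)

lemma isUnit_norm : IsUnit (re ^ 2 + im ^ 2) := by
  have h := IsLocalization.Away.algebraMap_isUnit (S := DeligneTorus) torusNorm
  simpa [torusNorm, re, im] using h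

section lift
variable {R : Type*} [CommRing R] [Algebra ℝ R]

/-- The point `a + b i` of `S` with values in `R`. -/
def lift (a b : R) (hab : IsUnit (a ^ 2 + b ^ 2)) : DeligneTorus →ₐ[ℝ] R :=
  IsLocalization.liftAlgHom (M := Submonoid.powers torusNorm)
    (f := MvPolynomial.aeval ![a, b]) (by
      rintro ⟨_, n, rfl⟩
      simpa [torusNorm] using hab.pow n)

@[simp] lemma lift_re (a b : R) (hab : IsUnit (a ^ 2 + b ^ 2)) : lift a b hab re = a := by
  simp [lift, re]

@[simp] lemma lift_im (a b : R) (hab : IsUnit (a ^ 2 + b ^ 2)) : lift a b hab im = b := by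
  simp [lift, im]

lemma algHom_ext {f g : DeligneTorus →ₐ[ℝ] R} (h₁ : f re = g re) (h₂ : f im = g im) : f = g := by
  refine IsLocalization.algHom_ext (Submonoid.powers torusNorm) ?_
  refine MvPolynomial.algHom_ext fun i => ?_
  fin_cases i
  · exact h₁
  · exact h₂

end lift

/-- The function `(a ^ 2 + b ^ 2)⁻¹`. -/
def inv : DeligneTorus := ↑(isUnit_norm.unit⁻¹)

lemma norm_mul_inv : (re ^ 2 + im ^ 2) * inv = 1 := isUnit_norm.mul_val_inv

lemma isUnit_norm_mul : IsUnit ((re ⊗ₜ[ℝ] re - im ⊗ₜ[ℝ] im) ^ 2 +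
    (re ⊗ₜ[ℝ] im + im ⊗ₜ[ℝ] re) ^ 2) := by
  have h : (re ⊗ₜ[ℝ] re - im ⊗ₜ[ℝ] im) ^ 2 + (re ⊗ₜ[ℝ] im + im ⊗ₜ[ℝ] re) ^ 2 =
      (re ^ 2 + im ^ 2) ⊗ₜ[ℝ] (re ^ 2 + im ^ 2) := by
    simp only [sub_eq_add_neg, pow_two, mul_add, add_mul, TensorProduct.add_tmul,
      TensorProduct.tmul_add, Algebra.TensorProduct.tmul_mul_tmul, neg_mul, mul_neg,
      mul_comm im re]
    abel
  rw [h]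
  refine .of_mul_eq_one (inv ⊗ₜ inv) ?_
  rw [Algebra.TensorProduct.tmul_mul_tmul, norm_mul_inv, Algebra.TensorProduct.one_def]

/-- The multiplication `(a + b i) (c + d i) = (a c - b d) + (a d + b c) i` and the unit `1`. -/
instance : Bialgebra ℝ DeligneTorus :=
  .ofAlgHom
    (lift (re ⊗ₜ[ℝ] re - im ⊗ₜ[ℝ] im) (re ⊗ₜ[ℝ] im + im ⊗ₜ[ℝ] re) isUnit_norm_mul)
    (lift 1 0 (by simp))
    (by
      apply algHom_ext <;>
      simp [TensorProduct.add_tmul, TensorProduct.tmul_add, TensorProduct.sub_tmul,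
        TensorProduct.tmul_sub] <;> abel)
    (by apply algHom_ext <;> simp [sub_eq_add_neg])
    (by apply algHom_ext <;> simp [sub_eq_add_neg])

@[simp] lemma comul_re : Coalgebra.comul (R := ℝ) re = re ⊗ₜ[ℝ] re - im ⊗ₜ[ℝ] im :=
  lift_re _ _ isUnit_norm_mul
@[simp] lemma comul_im : Coalgebra.comul (R := ℝ) im = re ⊗ₜ[ℝ] im + im ⊗ₜ[ℝ] re :=
  lift_im _ _ isUnit_norm_mul
@[simp] lemma counit_re : Coalgebra.counit (R := ℝ) re = 1 := lift_re (1 : ℝ) 0 (by simp)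
@[simp] lemma counit_im : Coalgebra.counit (R := ℝ) im = 0 := lift_im (1 : ℝ) 0 (by simp)

/-- The inverse `(a + b i)⁻¹ = (a - b i) / (a ^ 2 + b ^ 2)`. -/
instance : HopfAlgebra ℝ DeligneTorus :=
  .ofAlgHom
    (lift (re * inv) (-im * inv) (by
      refine .of_mul_eq_one (re ^ 2 + im ^ 2) ?_
      linear_combination (re ^ 2 + im ^ 2) * inv * norm_mul_inv + norm_mul_inv))
    (by
      apply algHom_ext <;> simp
      · linear_combination norm_mul_inv
      · ring)
    (by
      apply algHom_ext <;> simp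
      · linear_combination norm_mul_inv
      · ring)

/-- The real point of `S` given by `z ∈ ℂˣ = S(ℝ)`. -/
def point (z : ℂˣ) : DeligneTorus →ₐ[ℝ] ℝ :=
  lift (z : ℂ).re (z : ℂ).im (by
    have h : Complex.normSq (z : ℂ) ≠ 0 := by simp
    rw [Complex.normSq_apply] at h
    rw [isUnit_iff_ne_zero, pow_two, pow_two]
    exact h)

end DeligneTorus
section Adjoint

open WithConv Algebra.TensorProduct Coalgebra

variable {k : Type v} [Field k] {A : Type u} [CommRing A] [HopfAlgebra k A]

/-- A point `z ∈ G(R)` is central (lies in `Z(G)(R)`) if it commutes with all points of `G` over all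
`R`-algebras, equivalently with the universal point of `G` over `A ⊗ R`. -/
def IsCentral {R : Type w} [CommRing R] [Algebra k R] (z : A →ₐ[k] R) : Prop :=
  (toConv includeLeft * toConv (includeRight.comp z) : WithConv (A →ₐ[k] A ⊗[k] R)) =
    toConv (includeRight.comp z) * toConv includeLeft

lemma conv_left_right {R : Type w} [CommRing R] [Algebra k R] (z : A →ₐ[k] R) (a : A) :
    (toConv includeLeft * toConv (includeRight.comp z) : WithConv (A →ₐ[k] A ⊗[k] R)) a =
      z.toLinearMap.lTensor A (comul (R := k) a) := by
  rw [AlgHom.convMul_apply]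
  induction comul (R := k) a using TensorProduct.induction_on with
  | zero => simp
  | tmul x y => simp
  | add x y hx hy => rw [map_add, map_add, hx, hy]

lemma conv_right_left {R : Type w} [CommRing R] [Algebra k R] (z : A →ₐ[k] R) (a : A) :
    (toConv (includeRight.comp z) * toConv includeLeft : WithConv (A →ₐ[k] A ⊗[k] R)) a =
      z.toLinearMap.lTensor A (TensorProduct.comm k A A (comul (R := k) a)) := by
  rw [AlgHom.convMul_apply]
  induction comul (R := k) a using TensorProduct.induction_on with
  | zero => simp
  | tmul x y => simp
  | add x y hx hy => simp only [map_add, hx, hy]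

variable (k A) in
/-- The coordinate ring of `G^ad = G / Z(G)`: the functions `f` on `G` with `f (g z) = f g` for all
points `g` of `G` and `z` of the centre `Z(G)` (`g` is again the universal point). -/
def adjointSubalgebra : Subalgebra k A where
  carrier := {f | ∀ (R : Type u) [CommRing R] [Algebra k R] (z : A →ₐ[k] R), IsCentral z →
    (toConv includeLeft * toConv (includeRight.comp z) : WithConv (A →ₐ[k] A ⊗[k] R)) f = f ⊗ₜ 1}
  mul_mem' {a b} ha hb R _ _ z hz := by
    have h := map_mul (toConv includeLeft * toConv (includeRight.comp z) :
      WithConv (A →ₐ[k] A ⊗[k] R)).ofConv a b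
    refine h.trans ?_
    refine (congrArg₂ (· * ·) (ha R z hz) (hb R z hz)).trans ?_
    simp
  add_mem' {a b} ha hb R _ _ z hz := by
    have h := map_add (toConv includeLeft * toConv (includeRight.comp z) :
      WithConv (A →ₐ[k] A ⊗[k] R)).ofConv a b
    refine h.trans ?_
    refine (congrArg₂ (· + ·) (ha R z hz) (hb R z hz)).trans ?_
    rw [TensorProduct.add_tmul]
  algebraMap_mem' c R _ _ z hz := by
    refine (AlgHom.commutes (toConv includeLeft * toConv (includeRight.comp z) :
      WithConv (A →ₐ[k] A ⊗[k] R)).ofConv c).trans ?_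
    simp [Algebra.TensorProduct.algebraMap_apply]

lemma mem_adjointSubalgebra_iff {f : A} : f ∈ adjointSubalgebra k A ↔
    ∀ (R : Type u) [CommRing R] [Algebra k R] (z : A →ₐ[k] R), IsCentral z →
      z.toLinearMap.lTensor A (comul (R := k) f) = f ⊗ₜ 1 := by
  simp_rw [← conv_left_right]
  rfl

lemma IsCentral.comul_eq {R : Type w} [CommRing R] [Algebra k R] {z : A →ₐ[k] R}
    (hz : IsCentral z) (a : A) :
    z.toLinearMap.lTensor A (comul (R := k) a) =
      z.toLinearMap.lTensor A (TensorProduct.comm k A A (comul (R := k) a)) := by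
  rw [← conv_left_right, ← conv_right_left]
  exact congrArg (fun F : WithConv (A →ₐ[k] A ⊗[k] R) => F a) hz

lemma leftSlice_mem {f : A} (hf : f ∈ adjointSubalgebra k A) (l : A →ₗ[k] k) :
    TensorProduct.lid k A (l.rTensor A (comul (R := k) f)) ∈ adjointSubalgebra k A := by
  rw [mem_adjointSubalgebra_iff] at hf ⊢
  intro R _ _ z hz
  have h1 : ∀ t : A ⊗[k] A,
      z.toLinearMap.lTensor A (comul (R := k) (TensorProduct.lid k A (l.rTensor A t))) =
      TensorProduct.lid k (A ⊗[k] R) (l.rTensor (A ⊗[k] R)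
        ((z.toLinearMap.lTensor A).lTensor A ((comul (R := k)).lTensor A t))) := by
    intro t
    induction t using TensorProduct.induction_on with
    | zero => simp
    | tmul x y => simp
    | add x y hx hy => simp only [map_add, hx, hy]
  have h2 : ∀ t : A ⊗[k] A, (z.toLinearMap.lTensor A).lTensor A
      (TensorProduct.assoc k A A A ((comul (R := k)).rTensor A t)) =
      TensorProduct.assoc k A A R ((comul (R := k)).rTensor R (z.toLinearMap.lTensor A t)) := by
    intro t
    induction t using TensorProduct.induction_on with
    | zero => simp
    | tmul x y =>
      simp only [LinearMap.rTensor_tmul, LinearMap.lTensor_tmul]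
      induction comul (R := k) x using TensorProduct.induction_on with
      | zero => simp
      | tmul x y => simp
      | add x y hx hy => simp only [map_add, hx, hy, TensorProduct.add_tmul]
    | add x y hx hy => simp only [map_add, hx, hy]
  have h3 : ∀ t : A ⊗[k] A, TensorProduct.lid k (A ⊗[k] R) (l.rTensor (A ⊗[k] R)
      (TensorProduct.assoc k A A R (t ⊗ₜ 1))) =
      TensorProduct.lid k A (l.rTensor A t) ⊗ₜ 1 := by
    intro t
    induction t using TensorProduct.induction_on with
    | zero => simp
    | tmul x y => simp [TensorProduct.smul_tmul']
    | add x y hx hy => simp only [map_add, hx, hy, TensorProduct.add_tmul]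
  rw [h1, ← Coalgebra.coassoc_apply, h2, hf R z hz, LinearMap.rTensor_tmul, h3]

lemma rightSlice_mem {f : A} (hf : f ∈ adjointSubalgebra k A) (l : A →ₗ[k] k) :
    TensorProduct.rid k A (l.lTensor A (comul (R := k) f)) ∈ adjointSubalgebra k A := by
  rw [mem_adjointSubalgebra_iff] at hf ⊢
  intro R _ _ z hz
  have h1 : ∀ t : A ⊗[k] A,
      z.toLinearMap.lTensor A (comul (R := k) (TensorProduct.rid k A (l.lTensor A t))) =
      ((TensorProduct.rid k R).toLinearMap ∘ₗ TensorProduct.map z.toLinearMap l).lTensor A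
        (TensorProduct.assoc k A A A ((comul (R := k)).rTensor A t)) := by
    intro t
    induction t using TensorProduct.induction_on with
    | zero => simp
    | tmul x y =>
      simp only [LinearMap.rTensor_tmul, LinearMap.lTensor_tmul, TensorProduct.rid_tmul, map_smul]
      induction comul (R := k) x using TensorProduct.induction_on with
      | zero => simp
      | tmul x y => simp
      | add x y hx hy => simp only [map_add, hx, hy, TensorProduct.add_tmul, smul_add]
    | add x y hx hy => simp only [map_add, hx, hy]
  have h2 : ((TensorProduct.rid k R).toLinearMap ∘ₗ TensorProduct.map z.toLinearMap l) ∘ₗ comul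
      = ((TensorProduct.lid k R).toLinearMap ∘ₗ TensorProduct.map l z.toLinearMap) ∘ₗ comul := by
    ext a
    have e1 : ∀ t : A ⊗[k] A, TensorProduct.rid k R (TensorProduct.map z.toLinearMap l t) =
        TensorProduct.lid k R (l.rTensor R (z.toLinearMap.lTensor A
          (TensorProduct.comm k A A t))) := by
      intro t
      induction t using TensorProduct.induction_on with
      | zero => simp
      | tmul x y => simp
      | add x y hx hy => simp only [map_add, hx, hy]
    have e2 : ∀ t : A ⊗[k] A, TensorProduct.lid k R (TensorProduct.map l z.toLinearMap t) =
        TensorProduct.lid k R (l.rTensor R (z.toLinearMap.lTensor A t)) := by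
      intro t
      induction t using TensorProduct.induction_on with
      | zero => simp
      | tmul x y => simp
      | add x y hx hy => simp only [map_add, hx, hy]
    simp only [LinearMap.comp_apply, LinearEquiv.coe_coe]
    rw [e1, e2, hz.comul_eq]
  have h3 : ∀ t : A ⊗[k] A,
      ((TensorProduct.lid k R).toLinearMap ∘ₗ TensorProduct.map l z.toLinearMap).lTensor A
        (TensorProduct.assoc k A A A ((comul (R := k)).rTensor A t)) =
      ((TensorProduct.rid k A).toLinearMap ∘ₗ l.lTensor A).rTensor R
        ((comul (R := k)).rTensor R (z.toLinearMap.lTensor A t)) := by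
    intro t
    induction t using TensorProduct.induction_on with
    | zero => simp
    | tmul x y =>
      simp only [LinearMap.rTensor_tmul, LinearMap.lTensor_tmul]
      induction comul (R := k) x using TensorProduct.induction_on with
      | zero => simp
      | tmul x y => simp [TensorProduct.smul_tmul']
      | add x y hx hy => simp only [map_add, hx, hy, TensorProduct.add_tmul]
    | add x y hx hy => simp only [map_add, hx, hy]
  rw [h1, Coalgebra.coassoc_apply, ← LinearMap.comp_apply, ← LinearMap.lTensor_comp, h2,
    LinearMap.lTensor_comp, LinearMap.comp_apply, ← Coalgebra.coassoc_apply, h3, hf R z hz]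
  simp

lemma toConv_comp_antipode_mul {R : Type w} [CommRing R] [Algebra k R] (g : A →ₐ[k] R) :
    toConv (g.comp (HopfAlgebra.antipodeAlgHom k A)) * toConv g = 1 := by
  have h := AlgHom.comp_convMul_distrib g (toConv (HopfAlgebra.antipodeAlgHom k A))
    (toConv (AlgHom.id k A))
  rw [AlgHom.antipode_id_cancel] at h
  apply WithConv.ofConv_injective
  refine h.symm.trans ?_
  ext a
  simp [AlgHom.convOne_def]

lemma mul_toConv_comp_antipode {R : Type w} [CommRing R] [Algebra k R] (g : A →ₐ[k] R) :
    toConv g * toConv (g.comp (HopfAlgebra.antipodeAlgHom k A)) = 1 := by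
  have h0 : toConv (AlgHom.id k A) * toConv (HopfAlgebra.antipodeAlgHom k A) = 1 := by
    apply WithConv.ofConv_injective
    apply AlgHom.toLinearMap_injective
    apply WithConv.toConv_injective
    rw [AlgHom.toLinearMap_convMul, AlgHom.toLinearMap_convOne]
    simp [LinearMap.id_mul_antipode]
  have h := AlgHom.comp_convMul_distrib g (toConv (AlgHom.id k A))
    (toConv (HopfAlgebra.antipodeAlgHom k A))
  rw [h0] at h
  apply WithConv.ofConv_injective
  refine h.symm.trans ?_
  ext a
  simp [AlgHom.convOne_def]

lemma IsCentral.inv {R : Type w} [CommRing R] [Algebra k R] {z : A →ₐ[k] R}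
    (hz : IsCentral z) : IsCentral (z.comp (HopfAlgebra.antipodeAlgHom k A)) := by
  have hl := toConv_comp_antipode_mul (includeRight.comp z : A →ₐ[k] A ⊗[k] R)
  have hr := mul_toConv_comp_antipode (includeRight.comp z : A →ₐ[k] A ⊗[k] R)
  have hc : Commute (toConv includeLeft : WithConv (A →ₐ[k] A ⊗[k] R))
    (toConv (includeRight.comp z)) := hz
  let U : (WithConv (A →ₐ[k] A ⊗[k] R))ˣ := ⟨_, _, hr, hl⟩
  have hc' : Commute (toConv includeLeft : WithConv (A →ₐ[k] A ⊗[k] R)) (U : _) := hc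
  exact hc'.units_inv_right

lemma antipode_mem {f : A} (hf : f ∈ adjointSubalgebra k A) :
    HopfAlgebra.antipode k f ∈ adjointSubalgebra k A := by
  intro R _ _ z hz
  have hl := toConv_comp_antipode_mul (includeRight.comp z : A →ₐ[k] A ⊗[k] R)
  have hr := mul_toConv_comp_antipode (includeRight.comp z : A →ₐ[k] A ⊗[k] R)
  have hl' := toConv_comp_antipode_mul (includeLeft : A →ₐ[k] A ⊗[k] R)
  have hr' := mul_toConv_comp_antipode (includeLeft : A →ₐ[k] A ⊗[k] R)
  have H := mul_toConv_comp_antipode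
    (toConv includeLeft * toConv (includeRight.comp z) : WithConv (A →ₐ[k] A ⊗[k] R)).ofConv
  have hz' := hz.inv
  have key : toConv ((toConv includeLeft * toConv (includeRight.comp z) :
      WithConv (A →ₐ[k] A ⊗[k] R)).ofConv.comp (HopfAlgebra.antipodeAlgHom k A)) =
      toConv ((includeLeft : A →ₐ[k] A ⊗[k] R).comp (HopfAlgebra.antipodeAlgHom k A)) *
      toConv (includeRight.comp (z.comp (HopfAlgebra.antipodeAlgHom k A))) := by
    refine (left_inv_eq_right_inv ?_ H).symm
    have e : (toConv (includeRight.comp z) * toConv includeLeft : WithConv (A →ₐ[k] A ⊗[k] R)) =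
      toConv includeLeft * toConv (includeRight.comp z) := hz.symm
    change _ * (toConv includeLeft * toConv (includeRight.comp z)) = 1
    rw [← e, mul_assoc, ← mul_assoc (toConv (includeRight.comp (z.comp _)))]
    rw [← AlgHom.comp_assoc, hl, one_mul, hl']
  have e1 := congrArg (fun F : WithConv (A →ₐ[k] A ⊗[k] R) => F f) key
  refine e1.trans ?_
  have e2 := hf R _ hz'
  rw [conv_left_right] at e2
  have e3 := congrArg ((HopfAlgebra.antipode k (A := A)).rTensor R) e2
  rw [LinearMap.rTensor_tmul] at e3
  rw [← e3]
  rw [AlgHom.convMul_apply]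
  induction comul (R := k) f using TensorProduct.induction_on with
  | zero => simp
  | tmul x y => simp
  | add x y hx hy => simp only [map_add, hx, hy]


variable (k A) in
/-- The Hopf algebra `O(G^ad)` of the adjoint group `G^ad = G / Z(G)`. -/
abbrev AdjointRing : Type u := adjointSubalgebra k A

lemma tensor_val_injective : Function.Injective
    (Algebra.TensorProduct.map (adjointSubalgebra k A).val (adjointSubalgebra k A).val) :=
  TensorProduct.map_injective_of_flat_flat (adjointSubalgebra k A).val.toLinearMap
    (adjointSubalgebra k A).val.toLinearMap Subtype.val_injective Subtype.val_injective

lemma eq_of_leftSlice {V W : Type*} [AddCommGroup V] [Module k V] [AddCommGroup W] [Module k W]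
    {s t : V ⊗[k] W}
    (h : ∀ l : V →ₗ[k] k, TensorProduct.lid k W (l.rTensor W s) =
      TensorProduct.lid k W (l.rTensor W t)) : s = t := by
  classical
  let b := Module.Basis.ofVectorSpace k V
  apply (TensorProduct.equivFinsuppOfBasisLeft b).injective
  ext i
  have key : ∀ r : V ⊗[k] W, TensorProduct.equivFinsuppOfBasisLeft b r i =
      TensorProduct.lid k W ((b.coord i).rTensor W r) := by
    intro r
    induction r using TensorProduct.induction_on with
    | zero => simp
    | tmul x y => simp
    | add x y hx hy => simp only [map_add, Finsupp.add_apply, hx, hy]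
  rw [key, key, h]

lemma comul_mem_range (f : adjointSubalgebra k A) :
    comul (R := k) (f : A) ∈ (Algebra.TensorProduct.map (adjointSubalgebra k A).val
      (adjointSubalgebra k A).val).range := by
  obtain ⟨p, hp⟩ := LinearMap.exists_leftInverse_of_injective
    (adjointSubalgebra k A).val.toLinearMap (LinearMap.ker_eq_bot.2 Subtype.val_injective)
  have hp' : ∀ a ∈ adjointSubalgebra k A, ((p a : adjointSubalgebra k A) : A) = a := fun a ha =>
    congrArg Subtype.val (LinearMap.congr_fun hp ⟨a, ha⟩)
  let e : A →ₗ[k] A := (adjointSubalgebra k A).val.toLinearMap ∘ₗ p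
  have h1 : e.lTensor A (comul (R := k) (f : A)) = comul (R := k) (f : A) := by
    refine eq_of_leftSlice fun l => ?_
    have := hp' _ (leftSlice_mem f.2 l)
    refine Eq.trans ?_ this
    change _ = e _
    generalize comul (R := k) (f : A) = t
    induction t using TensorProduct.induction_on with
    | zero => simp
    | tmul x y => simp
    | add x y hx hy => simp only [map_add, hx, hy]
  have h2 : e.rTensor A (comul (R := k) (f : A)) = comul (R := k) (f : A) := by
    apply (TensorProduct.comm k A A).injective
    refine eq_of_leftSlice fun l => ?_
    have := hp' _ (rightSlice_mem f.2 l)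
    have e1 : ∀ t : A ⊗[k] A, TensorProduct.lid k A (l.rTensor A (TensorProduct.comm k A A t)) =
        TensorProduct.rid k A (l.lTensor A t) := by
      intro t
      induction t using TensorProduct.induction_on with
      | zero => simp
      | tmul x y => simp
      | add x y hx hy => simp only [map_add, hx, hy]
    rw [e1, e1]
    refine Eq.trans ?_ this
    change _ = e _
    generalize comul (R := k) (f : A) = t
    induction t using TensorProduct.induction_on with
    | zero => simp
    | tmul x y => simp
    | add x y hx hy => simp only [map_add, hx, hy]
  refine ⟨TensorProduct.map p p (comul (R := k) (f : A)), ?_⟩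
  rw [← h1, ← h2]
  generalize comul (R := k) (f : A) = t
  change Algebra.TensorProduct.map _ _ _ = _
  have hpe : ∀ a, p (e a) = p a := fun a => LinearMap.congr_fun hp (p a)
  induction t using TensorProduct.induction_on with
  | zero => simp
  | tmul x y => simp [hpe]; simp [e]
  | add x y hx hy => simp only [map_add, hx, hy]

variable (k A) in
/-- The comultiplication of `O(G)`, restricted to `O(G^ad)`. -/
def adjointComul : AdjointRing k A →ₐ[k] AdjointRing k A ⊗[k] AdjointRing k A :=
  (AlgEquiv.ofInjective _ (tensor_val_injective (k := k) (A := A))).symm.toAlgHom.comp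
    (((Bialgebra.comulAlgHom k A).comp (adjointSubalgebra k A).val).codRestrict _ comul_mem_range)

lemma map_val_adjointComul (f : AdjointRing k A) :
    Algebra.TensorProduct.map (adjointSubalgebra k A).val (adjointSubalgebra k A).val
      (adjointComul k A f) = comul (R := k) (f : A) :=
  congrArg Subtype.val ((AlgEquiv.ofInjective _ (tensor_val_injective (k := k) (A := A))).apply_symm_apply
    ⟨comul (R := k) (f : A), comul_mem_range f⟩)

instance : Bialgebra k (AdjointRing k A) :=
  .ofAlgHom (adjointComul k A) ((Bialgebra.counitAlgHom k A).comp (adjointSubalgebra k A).val)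
    (by
      have inj : Function.Injective (Algebra.TensorProduct.map (adjointSubalgebra k A).val
          (Algebra.TensorProduct.map (adjointSubalgebra k A).val (adjointSubalgebra k A).val)) :=
        TensorProduct.map_injective_of_flat_flat (adjointSubalgebra k A).val.toLinearMap
          (Algebra.TensorProduct.map (adjointSubalgebra k A).val
            (adjointSubalgebra k A).val).toLinearMap Subtype.val_injective tensor_val_injective
      ext f : 1
      apply inj
      have e1 : ∀ t : AdjointRing k A ⊗[k] AdjointRing k A,
          Algebra.TensorProduct.map (adjointSubalgebra k A).val
            (Algebra.TensorProduct.map (adjointSubalgebra k A).val (adjointSubalgebra k A).val)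
            (Algebra.TensorProduct.assoc k k k _ _ _
              (Algebra.TensorProduct.map (adjointComul k A) (AlgHom.id k _) t)) =
          TensorProduct.assoc k A A A ((comul (R := k)).rTensor A
            (Algebra.TensorProduct.map (adjointSubalgebra k A).val
              (adjointSubalgebra k A).val t)) := by
        intro t
        induction t using TensorProduct.induction_on with
        | zero => simp
        | tmul x y =>
          simp only [Algebra.TensorProduct.map_tmul, LinearMap.rTensor_tmul,
            Subalgebra.coe_val, ← map_val_adjointComul]
          induction adjointComul k A x using TensorProduct.induction_on with
          | zero => simp
          | tmul x y => simp
          | add x y hx hy => simp only [map_add, hx, hy, TensorProduct.add_tmul]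
        | add x y hx hy => simp only [map_add, hx, hy]
      have e2 : ∀ t : AdjointRing k A ⊗[k] AdjointRing k A,
          Algebra.TensorProduct.map (adjointSubalgebra k A).val
            (Algebra.TensorProduct.map (adjointSubalgebra k A).val (adjointSubalgebra k A).val)
            (Algebra.TensorProduct.map (AlgHom.id k _) (adjointComul k A) t) =
          (comul (R := k)).lTensor A
            (Algebra.TensorProduct.map (adjointSubalgebra k A).val
              (adjointSubalgebra k A).val t) := by
        intro t
        induction t using TensorProduct.induction_on with
        | zero => simp
        | tmul x y => simp [map_val_adjointComul]
        | add x y hx hy => simp only [map_add, hx, hy]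
      refine (e1 (adjointComul k A f)).trans (Eq.trans ?_ (e2 (adjointComul k A f)).symm)
      rw [map_val_adjointComul, Coalgebra.coassoc_apply])
    (by
      ext f : 1
      apply (TensorProduct.lid k _).injective
      apply Subtype.val_injective
      have e : ∀ t : AdjointRing k A ⊗[k] AdjointRing k A,
          ((TensorProduct.lid k _ (Algebra.TensorProduct.map
            ((Bialgebra.counitAlgHom k A).comp (adjointSubalgebra k A).val)
            (AlgHom.id k _) t) : AdjointRing k A) : A) =
          TensorProduct.lid k A ((counit (R := k)).rTensor A
            (Algebra.TensorProduct.map (adjointSubalgebra k A).val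
              (adjointSubalgebra k A).val t)) := by
        intro t
        induction t using TensorProduct.induction_on with
        | zero => simp
        | tmul x y => simp
        | add x y hx hy => simp only [map_add, hx, hy, Subalgebra.coe_add]
      refine (e (adjointComul k A f)).trans ?_
      rw [map_val_adjointComul]
      simp)
    (by
      ext f : 1
      apply (TensorProduct.rid k _).injective
      apply Subtype.val_injective
      have e : ∀ t : AdjointRing k A ⊗[k] AdjointRing k A,
          ((TensorProduct.rid k _ (Algebra.TensorProduct.map (AlgHom.id k _)
            ((Bialgebra.counitAlgHom k A).comp (adjointSubalgebra k A).val)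
            t) : AdjointRing k A) : A) =
          TensorProduct.rid k A ((counit (R := k)).lTensor A
            (Algebra.TensorProduct.map (adjointSubalgebra k A).val
              (adjointSubalgebra k A).val t)) := by
        intro t
        induction t using TensorProduct.induction_on with
        | zero => simp
        | tmul x y => simp
        | add x y hx hy => simp only [map_add, hx, hy, Subalgebra.coe_add]
      refine (e (adjointComul k A f)).trans ?_
      rw [map_val_adjointComul]
      simp)

lemma map_val_comul (f : AdjointRing k A) :
    Algebra.TensorProduct.map (adjointSubalgebra k A).val (adjointSubalgebra k A).val
      (comul (R := k) f) = comul (R := k) (f : A) :=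
  map_val_adjointComul f

lemma counit_adjoint (f : AdjointRing k A) :
    counit (R := k) f = counit (R := k) (f : A) := rfl

variable (k A) in
/-- The antipode of `O(G)`, restricted to `O(G^ad)`. -/
def adjointAntipode : AdjointRing k A →ₐ[k] AdjointRing k A :=
  ((HopfAlgebra.antipodeAlgHom k A).comp (adjointSubalgebra k A).val).codRestrict _
    fun f => antipode_mem f.2

lemma coe_adjointAntipode (f : AdjointRing k A) :
    (adjointAntipode k A f : A) = HopfAlgebra.antipode k (f : A) := rfl

instance : HopfAlgebra k (AdjointRing k A) :=
  .ofAlgHom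
    (adjointAntipode k A)
    (by
      ext f
      have e : ∀ t : AdjointRing k A ⊗[k] AdjointRing k A,
          ((Algebra.TensorProduct.lift (adjointAntipode k A)
            (AlgHom.id k _) (fun _ _ => Commute.all _ _) t : AdjointRing k A) : A) =
          LinearMap.mul' k A ((HopfAlgebra.antipode k).rTensor A
            (Algebra.TensorProduct.map (adjointSubalgebra k A).val
              (adjointSubalgebra k A).val t)) := by
        intro t
        induction t using TensorProduct.induction_on with
        | zero => simp
        | tmul x y => simp [coe_adjointAntipode]
        | add x y hx hy => simp only [map_add, hx, hy, Subalgebra.coe_add]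
      refine (e _).trans ?_
      refine (congrArg (fun t => LinearMap.mul' k A ((HopfAlgebra.antipode k).rTensor A t))
        (map_val_comul f)).trans ?_
      rw [HopfAlgebra.mul_antipode_rTensor_comul_apply]
      rfl)
    (by
      ext f
      have e : ∀ t : AdjointRing k A ⊗[k] AdjointRing k A,
          ((Algebra.TensorProduct.lift (AlgHom.id k _) (adjointAntipode k A)
            (fun _ _ => Commute.all _ _) t : AdjointRing k A) : A) =
          LinearMap.mul' k A ((HopfAlgebra.antipode k).lTensor A
            (Algebra.TensorProduct.map (adjointSubalgebra k A).val
              (adjointSubalgebra k A).val t)) := by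
        intro t
        induction t using TensorProduct.induction_on with
        | zero => simp
        | tmul x y => simp [coe_adjointAntipode]
        | add x y hx hy => simp only [map_add, hx, hy, Subalgebra.coe_add]
      refine (e _).trans ?_
      refine (congrArg (fun t => LinearMap.mul' k A ((HopfAlgebra.antipode k).lTensor A t))
        (map_val_comul f)).trans ?_
      rw [HopfAlgebra.mul_antipode_lTensor_comul_apply]
      rfl)

variable (k A) in
/-- The quotient homomorphism `G → G^ad`, i.e. the inclusion `O(G^ad) ⊆ O(G)`. -/
def toAdjoint : AdjointRing k A →ₐc[k] A :=
  .ofAlgHom (adjointSubalgebra k A).val rfl (by ext f : 1; exact map_val_comul f)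

end Adjoint

section Normal

open WithConv Algebra.TensorProduct Coalgebra

variable (k : Type v) [Field k] {A : Type u} [CommRing A] [HopfAlgebra k A]

variable (A) in
/-- The morphism `G × G → G`, `(x, g) ↦ g x g⁻¹`. -/
def conjugation : A →ₐ[k] A ⊗[k] A :=
  (toConv includeRight * toConv includeLeft *
    toConv (includeRight.comp (HopfAlgebra.antipodeAlgHom k A)) :
      WithConv (A →ₐ[k] A ⊗[k] A)).ofConv

/-- The closed subgroup `N = V(I)` is normal: `g x g⁻¹ ∈ N` for `x ∈ N`, `g ∈ G`. -/
def IsNormal (I : Ideal A) : Prop :=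
  ∀ f ∈ I, Algebra.TensorProduct.map (Ideal.Quotient.mkₐ k I) (AlgHom.id k A)
    (conjugation k A f) = 0

variable (A) in
/-- `G` is unipotent: every nonzero subrepresentation `V` of the regular representation `O(G)`
has a nonzero fixed vector, i.e. contains the constants. (Every simple representation embeds in
the regular one, so this says that all simple representations are trivial.) -/
def IsUnipotent : Prop :=
  ∀ V : Submodule k A, V ≠ ⊥ →
    (∀ v ∈ V, comul (R := k) v ∈ LinearMap.range (V.subtype.rTensor A)) → (1 : A) ∈ V

variable (A) in
/-- `G` is a connected reductive algebraic group over `k`: of finite type, smooth and connected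
(stated as geometrically integral), and `G` over an algebraic closure has no nontrivial smooth
connected normal unipotent subgroup. -/
structure IsConnectedReductive : Prop where
  finiteType : Algebra.FiniteType k A
  connected : IsDomain (AlgebraicClosure k ⊗[k] A)
  reductive : ∀ (I : Ideal (AlgebraicClosure k ⊗[k] A)) [I.IsHopfIdeal (AlgebraicClosure k)],
    IsNormal (AlgebraicClosure k) I →
    IsDomain ((AlgebraicClosure k ⊗[k] A) ⧸ I) →
    IsUnipotent (AlgebraicClosure k) ((AlgebraicClosure k ⊗[k] A) ⧸ I) →
    I = RingHom.ker (Bialgebra.counitAlgHom (AlgebraicClosure k) (AlgebraicClosure k ⊗[k] A))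

end Normal

section DeligneHom

open WithConv Algebra.TensorProduct Coalgebra

/-- Homomorphisms `h : S → G_ℝ` of algebraic groups over `ℝ`, for `G` over `ℚ`. -/
abbrev DeligneHom (A : Type u) [CommRing A] [HopfAlgebra ℚ A] : Type u :=
  ℝ ⊗[ℚ] A →ₐc[ℝ] DeligneTorus

namespace DeligneHom

variable {A : Type u} [CommRing A] [HopfAlgebra ℚ A] {B : Type v} [CommRing B] [HopfAlgebra ℚ B]

/-- The composite `φ ∘ h : S → H_ℝ` for a homomorphism `φ : G → H` over `ℚ`. -/
def map (φ : B →ₐc[ℚ] A) (h : DeligneHom A) : DeligneHom B :=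
  h.comp (Bialgebra.TensorProduct.map (BialgHom.id ℝ ℝ) φ)

/-- `h` as a point of `G` with values in `O(S)`. -/
def restrict (h : DeligneHom A) : A →ₐ[ℚ] DeligneTorus :=
  ((h : ℝ ⊗[ℚ] A →ₐ[ℝ] DeligneTorus).restrictScalars ℚ).comp includeRight

@[simp] lemma restrict_apply (h : DeligneHom A) (a : A) : h.restrict a = h (1 ⊗ₜ a) := rfl

lemma restrict_injective : Function.Injective (restrict (A := A)) := by
  intro h h' e
  have : (h : ℝ ⊗[ℚ] A →ₐ[ℝ] DeligneTorus) = h' :=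
    Algebra.TensorProduct.ext (by ext) e
  ext x
  exact AlgHom.congr_fun this x

lemma counit_restrict (h : DeligneHom A) (a : A) :
    counit (R := ℝ) (h.restrict a) = (counit (R := ℚ) a : ℝ) := by
  rw [restrict_apply, CoalgHomClass.counit_comp_apply]
  simp [Algebra.smul_def]

/-- Auxiliary map `a ⊗ b ↦ f a ⊗ f b`. -/
def double (f : A →ₐ[ℚ] DeligneTorus) : A ⊗[ℚ] A →ₐ[ℚ] DeligneTorus ⊗[ℝ] DeligneTorus :=
  Algebra.TensorProduct.lift
    (((includeLeft : DeligneTorus →ₐ[ℝ] DeligneTorus ⊗[ℝ] DeligneTorus).restrictScalars ℚ).comp f)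
    (((includeRight : DeligneTorus →ₐ[ℝ] DeligneTorus ⊗[ℝ] DeligneTorus).restrictScalars ℚ).comp f)
    (fun _ _ => Commute.all _ _)

lemma double_tmul (f : A →ₐ[ℚ] DeligneTorus) (a b : A) :
    double f (a ⊗ₜ b) = f a ⊗ₜ[ℝ] f b := by
  simp [double]

lemma comul_one_tmul (a : A) : comul (R := ℝ) ((1 : ℝ) ⊗ₜ[ℚ] a) =
    Algebra.TensorProduct.lift
    (((includeLeft : ℝ ⊗[ℚ] A →ₐ[ℝ] (ℝ ⊗[ℚ] A) ⊗[ℝ] (ℝ ⊗[ℚ] A)).restrictScalars ℚ).comp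
      includeRight)
    (((includeRight : ℝ ⊗[ℚ] A →ₐ[ℝ] (ℝ ⊗[ℚ] A) ⊗[ℝ] (ℝ ⊗[ℚ] A)).restrictScalars ℚ).comp
      includeRight)
    (fun _ _ => Commute.all _ _) (comul (R := ℚ) a) := by
  rw [← (ℛ ℚ a).eq]
  simp only [map_sum, Algebra.TensorProduct.lift_tmul]
  rw [TensorProduct.comul_tmul, ← (ℛ ℚ a).eq]
  simp [TensorProduct.tmul_sum]

lemma comul_restrict (h : DeligneHom A) (a : A) :
    comul (R := ℝ) (h.restrict a) = double h.restrict (comul (R := ℚ) a) := by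
  rw [restrict_apply, ← CoalgHomClass.map_comp_comul_apply, comul_one_tmul]
  induction comul (R := ℚ) a using TensorProduct.induction_on with
  | zero => simp
  | tmul x y => simp [double_tmul]
  | add x y hx hy => simp only [map_add, hx, hy]

/-- A homomorphism `S → G_ℝ` from a multiplicative `O(S)`-valued point of `G`. -/
def ofAlgHom (f : A →ₐ[ℚ] DeligneTorus)
    (h₁ : ∀ a, counit (R := ℝ) (f a) = (counit (R := ℚ) a : ℝ))
    (h₂ : ∀ a, comul (R := ℝ) (f a) = double f (comul (R := ℚ) a)) : DeligneHom A :=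
  BialgHom.ofAlgHom (Algebra.TensorProduct.lift (Algebra.ofId ℝ DeligneTorus) f
      (fun _ _ => Commute.all _ _))
    (by
      refine Algebra.TensorProduct.ext (by ext) ?_
      ext a
      simp [h₁])
    (by
      refine Algebra.TensorProduct.ext (by ext) ?_
      ext a
      simp only [AlgHom.coe_comp, AlgHom.coe_restrictScalars', Function.comp_apply,
        includeRight_apply, Bialgebra.comulAlgHom_apply, lift_tmul, map_one, one_mul, h₂]
      rw [comul_one_tmul]
      induction comul (R := ℚ) a using TensorProduct.induction_on with
      | zero => simp
      | tmul x y => simp [double_tmul]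
      | add x y hx hy => simp only [map_add, hx, hy])

@[simp] lemma restrict_ofAlgHom (f : A →ₐ[ℚ] DeligneTorus)
    (h₁ : ∀ a, counit (R := ℝ) (f a) = (counit (R := ℚ) a : ℝ))
    (h₂ : ∀ a, comul (R := ℝ) (f a) = double f (comul (R := ℚ) a)) :
    (ofAlgHom f h₁ h₂).restrict = f := by
  ext a
  have : Algebra.TensorProduct.lift (Algebra.ofId ℝ DeligneTorus) f (fun _ _ => Commute.all _ _)
      ((1 : ℝ) ⊗ₜ[ℚ] a) = f a := by simp
  exact this

/-- The point `h(z) ∈ G(ℝ)` for `z ∈ ℂˣ = S(ℝ)`. -/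
def point (h : DeligneHom A) (z : ℂˣ) : A →ₐ[ℚ] ℝ :=
  ((DeligneTorus.point z).restrictScalars ℚ).comp h.restrict

/-- `h' = g h g⁻¹` for `g ∈ G(ℝ)`. -/
def IsConjugate (g : A →ₐ[ℚ] ℝ) (h h' : DeligneHom A) : Prop :=
  toConv h'.restrict =
    toConv (((Algebra.ofId ℝ DeligneTorus).restrictScalars ℚ).comp g) * toConv h.restrict *
    toConv ((((Algebra.ofId ℝ DeligneTorus).restrictScalars ℚ).comp g).comp
      (HopfAlgebra.antipodeAlgHom ℚ A))

/-- The composite `h^ad : S → G_ℝ → G^ad_ℝ`. -/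
def ad (h : DeligneHom A) : DeligneHom (AdjointRing ℚ A) := h.map (toAdjoint ℚ A)

/-- The ideal of the Mumford-Tate group of `h`: the smallest closed subgroup `H` of `G` over `ℚ` such
that `h` factors through `H_ℝ` (the largest Hopf ideal of `O(G)` on which `h` vanishes). -/
def mtIdeal (h : DeligneHom A) : Ideal A :=
  sSup {I : Ideal A | I.IsHopfIdeal ℚ ∧ ∀ a ∈ I, h (1 ⊗ₜ a) = 0}

lemma mtIdeal_le_ker (h : DeligneHom A) {a : A} (ha : a ∈ h.mtIdeal) : h (1 ⊗ₜ a) = 0 := by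
  have : h.mtIdeal ≤ RingHom.ker h.restrict :=
    sSup_le fun I hI a ha => hI.2 a ha
  exact this ha

instance (h : DeligneHom A) : h.mtIdeal.IsHopfIdeal ℚ where
  counit_eq_zero := by
    have : h.mtIdeal ≤ RingHom.ker (Bialgebra.counitAlgHom ℚ A) :=
      sSup_le fun I hI a ha =>
        have := hI.1
        Submodule.IsCoideal.counit_eq_zero (R := ℚ) (I := I.restrictScalars ℚ) ha
    exact fun a ha => this ha
  map_mkQ_comul_eq_zero := by
    have : h.mtIdeal ≤ RingHom.ker ((Algebra.TensorProduct.map (Ideal.Quotient.mkₐ ℚ h.mtIdeal)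
        (Ideal.Quotient.mkₐ ℚ h.mtIdeal)).comp (Bialgebra.comulAlgHom ℚ A)) := by
      refine sSup_le fun I hI a ha => ?_
      have := hI.1
      have hle : I ≤ h.mtIdeal := le_sSup hI
      have e : Algebra.TensorProduct.map (Ideal.Quotient.mkₐ ℚ I) (Ideal.Quotient.mkₐ ℚ I)
          (comul (R := ℚ) a) = 0 :=
        Submodule.IsCoideal.map_mkQ_comul_eq_zero (R := ℚ) (I := I.restrictScalars ℚ) ha
      have e2 := congrArg (Algebra.TensorProduct.map (Ideal.Quotient.factorₐ ℚ hle)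
        (Ideal.Quotient.factorₐ ℚ hle)) e
      rw [map_zero] at e2
      rw [RingHom.mem_ker, ← e2, AlgHom.comp_apply, Bialgebra.comulAlgHom_apply,
        ← AlgHom.comp_apply, ← Algebra.TensorProduct.map_comp]
      rfl
    exact fun a ha => this ha
  antipode_mem := by
    have : h.mtIdeal ≤ h.mtIdeal.comap (HopfAlgebra.antipodeAlgHom ℚ A) :=
      sSup_le fun I hI a ha =>
        have hle : I ≤ h.mtIdeal := le_sSup hI
        hle (hI.1.antipode_mem ha)
    exact fun a ha => this ha

/-- The coordinate ring of the Mumford-Tate group `M_h`. -/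
abbrev MumfordTate (h : DeligneHom A) : Type u := A ⧸ h.mtIdeal

/-- `h` as a homomorphism `S → (M_h)_ℝ`. -/
def toMumfordTate (h : DeligneHom A) : DeligneHom h.MumfordTate :=
  ofAlgHom (Ideal.Quotient.liftₐ h.mtIdeal h.restrict fun _ ha => h.mtIdeal_le_ker ha)
    (by
      intro a
      obtain ⟨a, rfl⟩ := Ideal.Quotient.mk_surjective a
      exact h.counit_restrict a)
    (by
      intro a
      obtain ⟨a, rfl⟩ := Ideal.Quotient.mk_surjective a
      refine (h.comul_restrict a).trans ?_
      rw [Bialgebra.Quotient.comul_mk]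
      induction comul (R := ℚ) a using TensorProduct.induction_on with
      | zero => simp
      | tmul x y => rw [double_tmul, TensorProduct.map_tmul, double_tmul]; rfl
      | add x y hx hy => simp only [map_add, hx, hy])

lemma map_toMumfordTate (h : DeligneHom A) :
    h.toMumfordTate.map (Bialgebra.Quotient.mkBialgHom h.mtIdeal) = h := by
  apply restrict_injective
  ext a
  have e : h.toMumfordTate.restrict (Ideal.Quotient.mk _ a) = h.restrict a := by
    rw [toMumfordTate, restrict_ofAlgHom]; rfl
  exact e

section Prod

variable {A₁ : Type u} [CommRing A₁] [HopfAlgebra ℚ A₁]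
  {A₂ : Type v} [CommRing A₂] [HopfAlgebra ℚ A₂]

variable (A₁ A₂) in
/-- The projection `G₁ × G₂ → G₁`. -/
def fst : A₁ →ₐc[ℚ] A₁ ⊗[ℚ] A₂ :=
  BialgHom.ofAlgHom (R := ℚ) (A := A₁) (B := A₁ ⊗[ℚ] A₂) includeLeft
     (AlgHom.ext fun a => by simp) (AlgHom.ext fun a => by
    simp only [AlgHom.coe_comp, Function.comp_apply, Bialgebra.comulAlgHom_apply,
      includeLeft_apply, TensorProduct.comul_tmul, Bialgebra.comul_one,
      Algebra.TensorProduct.one_def]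
    induction comul (R := ℚ) a using TensorProduct.induction_on with
    | zero => simp
    | tmul x y => simp
    | add x y hx hy => simp only [map_add, hx, hy, TensorProduct.add_tmul])

variable (A₁ A₂) in
/-- The projection `G₁ × G₂ → G₂`. -/
def snd : A₂ →ₐc[ℚ] A₁ ⊗[ℚ] A₂ :=
  BialgHom.ofAlgHom (R := ℚ) (A := A₂) (B := A₁ ⊗[ℚ] A₂) includeRight
     (AlgHom.ext fun a => by simp) (AlgHom.ext fun a => by
    simp only [AlgHom.coe_comp, Function.comp_apply, Bialgebra.comulAlgHom_apply,
      includeRight_apply, TensorProduct.comul_tmul, Bialgebra.comul_one,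
      Algebra.TensorProduct.one_def]
    induction comul (R := ℚ) a using TensorProduct.induction_on with
    | zero => simp
    | tmul x y => simp
    | add x y hx hy => simp only [map_add, hx, hy, TensorProduct.tmul_add])

/-- The homomorphism `(h₁, h₂) : S → (G₁ × G₂)_ℝ`. -/
def pair (h₁ : DeligneHom A₁) (h₂ : DeligneHom A₂) : DeligneHom (A₁ ⊗[ℚ] A₂) :=
  ofAlgHom (Algebra.TensorProduct.lift h₁.restrict h₂.restrict fun _ _ => Commute.all _ _)
    (by
      intro a
      induction a using TensorProduct.induction_on with
      | zero => simp
      | tmul x y =>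
        rw [lift_tmul, Bialgebra.counit_mul, counit_restrict, counit_restrict]
        simp [mul_comm]
      | add x y hx hy => simp only [map_add, hx, hy, Rat.cast_add])
    (by
      intro a
      induction a using TensorProduct.induction_on with
      | zero => simp
      | tmul x y =>
        rw [lift_tmul, Bialgebra.comul_mul, comul_restrict, comul_restrict,
          TensorProduct.comul_tmul, ← (ℛ ℚ x).eq, ← (ℛ ℚ y).eq]
        simp [TensorProduct.sum_tmul, TensorProduct.tmul_sum, double_tmul, Finset.sum_mul_sum]
        rw [Finset.sum_comm]
      | add x y hx hy => simp only [map_add, hx, hy])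

lemma restrict_pair (h₁ : DeligneHom A₁) (h₂ : DeligneHom A₂) : (pair h₁ h₂).restrict =
    Algebra.TensorProduct.lift h₁.restrict h₂.restrict fun _ _ => Commute.all _ _ :=
  restrict_ofAlgHom _ _ _

/-- The identification of homomorphisms `S → (G₁ × G₂)_ℝ` with pairs
of homomorphisms, by `h ↦ (pr₁ ∘ h, pr₂ ∘ h)`. -/
def prodEquiv : DeligneHom (A₁ ⊗[ℚ] A₂) ≃ DeligneHom A₁ × DeligneHom A₂ where
  toFun h := (h.map (fst A₁ A₂), h.map (snd A₁ A₂))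
  invFun p := pair p.1 p.2
  left_inv h := by
    apply restrict_injective
    rw [restrict_pair]
    apply Algebra.TensorProduct.ext
    · ext a
      simp only [AlgHom.coe_comp, Function.comp_apply, includeLeft_apply, lift_tmul, map_one,
        mul_one]
      rfl
    · ext a
      simp only [AlgHom.coe_comp, Function.comp_apply, includeRight_apply, lift_tmul, map_one,
        one_mul, AlgHom.coe_restrictScalars']
      rfl
  right_inv p := by
    ext1
    · apply restrict_injective
      ext a
      have e : (pair p.1 p.2).restrict (a ⊗ₜ 1) = p.1.restrict a := by
        rw [restrict_pair, lift_tmul, map_one, mul_one]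
      exact e
    · apply restrict_injective
      ext a
      have e : (pair p.1 p.2).restrict (1 ⊗ₜ a) = p.2.restrict a := by
        rw [restrict_pair, lift_tmul, map_one, one_mul]
      exact e

end Prod
end DeligneHom
end DeligneHom

section ShimuraDatum

open WithConv

variable {A : Type u} [CommRing A] [HopfAlgebra ℚ A]

variable (A) in
/-- `Lie(G)_ℂ`: the `ℂ`-valued derivations of `O(G)` at the identity. -/
def lieAlgebra : Submodule ℂ (A →ₗ[ℚ] ℂ) where
  carrier := {D | ∀ a b, D (a * b) =
    (Coalgebra.counit (R := ℚ) a : ℂ) * D b + (Coalgebra.counit (R := ℚ) b : ℂ) * D a}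
  add_mem' {D E} hD hE a b := by
    simp only [LinearMap.add_apply, hD a b, hE a b]; ring
  zero_mem' a b := by simp
  smul_mem' c D hD a b := by
    simp only [LinearMap.smul_apply, hD a b, smul_eq_mul]; ring

/-- The adjoint action of `g ∈ G(ℂ)`: `f ↦ D (x ↦ f (g x g⁻¹))`. -/
def Ad (g : A →ₐ[ℚ] ℂ) (D : A →ₗ[ℚ] ℂ) : A →ₗ[ℚ] ℂ :=
  (toConv g.toLinearMap * toConv D *
    toConv (g.comp (HopfAlgebra.antipodeAlgHom ℚ A)).toLinearMap).ofConv

/-- The inclusion `G(ℝ) ⊆ G(ℂ)`. -/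
def complexPoint (g : A →ₐ[ℚ] ℝ) : A →ₐ[ℚ] ℂ := (Complex.ofRealAm.restrictScalars ℚ).comp g

/-- Complex conjugation on `G(ℂ)`. -/
def conjPoint (g : A →ₐ[ℚ] ℂ) : A →ₐ[ℚ] ℂ :=
  ((Complex.conjAe : ℂ →ₐ[ℝ] ℂ).restrictScalars ℚ).comp g

/-- `D ∈ Lie(G)_ℂ` is of Hodge type `(-p, p)` for `Ad ∘ h`: `z ∈ ℂˣ` acts on it by `(z / z̄) ^ p`. -/
def HasHodgeType (h : DeligneHom A) (p : ℤ) (D : A →ₗ[ℚ] ℂ) : Prop :=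
  D ∈ lieAlgebra A ∧ ∀ z : ℂˣ,
    Ad (complexPoint (h.point z)) D = ((z : ℂ) / (starRingEnd ℂ) (z : ℂ)) ^ p • D

/-- `{g ∈ G(ℂ) | g = s ḡ s⁻¹}`, as a set of functions `O(G) → ℂ`. It carries the topology of pointwise
convergence, which is the usual topology of `G(ℂ)`. The involution `ad s` of `G_ℝ` is a Cartan
involution if this set is compact. -/
def compactForm (s : A →ₐ[ℚ] ℝ) : Set (A → ℂ) :=
  {F | ∃ g : A →ₐ[ℚ] ℂ, F = g ∧ toConv g = toConv (complexPoint s) * toConv (conjPoint g) *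
    toConv ((complexPoint s).comp (HopfAlgebra.antipodeAlgHom ℚ A))}

/-- `(G, X)` is a Shimura datum in the sense of Deligne: `G` is connected reductive over `ℚ`, `X` is
a `G(ℝ)`-conjugacy class of homomorphisms `S → G_ℝ`, and for `h ∈ X`
* `Lie(G)_ℂ` is of Hodge type `{(-1, 1), (0, 0), (1, -1)}`;
* `ad h(i)` is a Cartan involution of `G^ad_ℝ`;
* `G^ad` has no nontrivial quotient `G^ad / N` over `ℚ` (a factor of `G^ad`) in which `h` becomes
  trivial, i.e. such that `h^ad` factors through `N_ℝ`. -/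
structure IsShimuraDatum (X : Set (DeligneHom A)) : Prop where
  isConnectedReductive : IsConnectedReductive ℚ A
  isConjClass : ∃ h₀, X = {h | ∃ g : A →ₐ[ℚ] ℝ, DeligneHom.IsConjugate g h₀ h}
  hodgeType : ∀ h ∈ X, ∀ D ∈ lieAlgebra A, ∃ D₁ D₀ D₂ : A →ₗ[ℚ] ℂ,
    HasHodgeType h (-1) D₁ ∧ HasHodgeType h 0 D₀ ∧ HasHodgeType h 1 D₂ ∧ D = D₁ + D₀ + D₂
  cartan : ∀ h ∈ X, IsCompact (compactForm (h.ad.point (Units.mk0 Complex.I Complex.I_ne_zero)))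
  noFactor : ∀ h ∈ X, ∀ (N : Ideal (AdjointRing ℚ A)) [N.IsHopfIdeal ℚ],
    IsNormal ℚ N → (∀ a ∈ N, h.ad (1 ⊗ₜ a) = 0) → N = ⊥

/-- `x ∈ X_M` is Hodge generic: the Mumford-Tate group of `x^ad` is all of `M^ad`. For a point of a
Shimura datum this says that the Mumford-Tate group of `x` contains the derived group of `M`, or that
`x` lies in no special subvariety smaller than the connected component of `X_M` containing it. It
holds in particular if the Mumford-Tate group of `x` is `M`. -/
def IsHodgeGeneric (x : DeligneHom A) : Prop := x.ad.mtIdeal = ⊥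

variable {B : Type v} [CommRing B] [HopfAlgebra ℚ B]

/-- The hybrid Hecke orbit `Σ_X(M, X_M, x)`: the `x' ∈ X` for which there is a homomorphism
`φ : M^ad → M_{x'}^ad` over `ℚ` with `φ ∘ x^ad = x'^ad`, where `M_{x'}` is the Mumford-Tate group
of `x'`. -/
def hybridHeckeOrbit (X : Set (DeligneHom B)) (x : DeligneHom A) : Set (DeligneHom B) :=
  {x' ∈ X | ∃ φ : AdjointRing ℚ x'.MumfordTate →ₐc[ℚ] AdjointRing ℚ A,
    x.ad.map φ = x'.toMumfordTate.ad}

/-- `X₁ × X₂` as a set of homomorphisms `S → (G₁ × G₂)_ℝ`. -/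
def prodDatum {A₁ : Type u} [CommRing A₁] [HopfAlgebra ℚ A₁]
    {A₂ : Type v} [CommRing A₂] [HopfAlgebra ℚ A₂]
    (X₁ : Set (DeligneHom A₁)) (X₂ : Set (DeligneHom A₂)) : Set (DeligneHom (A₁ ⊗[ℚ] A₂)) :=
  DeligneHom.prodEquiv ⁻¹' (X₁ ×ˢ X₂)

end ShimuraDatum

end Shimura

end

/-!
The group `M_{φ ∘ h}` is the image of `M_h` under `φ`. Hence for `x' = (x₁', x₂')` the group
`M_{x'}` is a subgroup of `M_{x₁'} × M_{x₂'}` which surjects onto both factors. A surjection maps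
the centre into the centre, so it induces a homomorphism of adjoint groups; composing with
`M_{x'}^ad → M_{xᵢ'}^ad` gives one inclusion.

Conversely, let `φᵢ : M^ad → M_{xᵢ'}^ad` be given. An element of `M_{x'}` with central components is
central, so `M_{x'}^ad → M_{x₁'}^ad × M_{x₂'}^ad` has trivial kernel and is a closed immersion. Its
image is the Mumford-Tate group of the image of `x'^ad`. As `(φ₁, φ₂)` maps `x^ad` to the same
point and `x` is Hodge generic, it is also the image of `(φ₁, φ₂)`, which therefore factors through
`M_{x'}^ad`.

A homomorphism with trivial kernel is a closed immersion by descent. Let `B ⊆ E` be Hopf algebras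
such that `B` is a domain, as it is here because it embeds in `O(M^ad)`, and let `f ∈ E` take the
same value at any two points of `Spec E` which agree on `B`. Then `f`, and likewise each of its
translates, is a quotient of elements of `B`. The common denominators of the translates of `f` form
a nonzero translation-stable ideal of `B`, and the only such ideal is `B` itself.
-/

noncomputable section

namespace Shimura

section Points

open WithConv Algebra.TensorProduct Coalgebra

variable {k : Type*} [Field k] {A B : Type*} [CommRing A] [HopfAlgebra k A] [CommRing B]
  [HopfAlgebra k B] {R T : Type*} [CommRing R] [Algebra k R] [CommRing T] [Algebra k T]

/-- The group `G(R)`. Mathlib's `AlgHom.convGroup` covers only those `R` that carry a bialgebra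
structure. -/
instance pointGroup : Group (WithConv (A →ₐ[k] R)) where
  inv g := toConv (g.ofConv.comp (HopfAlgebra.antipodeAlgHom k A))
  inv_mul_cancel g := toConv_comp_antipode_mul g.ofConv

/-- The homomorphism `G(R) → G(T)` induced by a homomorphism `R → T` of algebras. -/
def mapPoints (f : R →ₐ[k] T) : WithConv (A →ₐ[k] R) →* WithConv (A →ₐ[k] T) :=
  MonoidHom.mk' (fun g => toConv (f.comp g.ofConv)) fun g h =>
    ofConv_injective (AlgHom.comp_convMul_distrib f g h)

@[simp] lemma mapPoints_toConv (f : R →ₐ[k] T) (g : A →ₐ[k] R) :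
    mapPoints f (toConv g) = toConv (f.comp g) := rfl

/-- The homomorphism `G(R) → H(R)` induced by a homomorphism `G → H` of affine groups. -/
def comapPoints (φ : B →ₐc[k] A) : WithConv (A →ₐ[k] R) →* WithConv (B →ₐ[k] R) :=
  MonoidHom.mk' (fun g => toConv (g.ofConv.comp (φ : B →ₐ[k] A))) fun g h =>
    ofConv_injective (AlgHom.convMul_comp_bialgHom_distrib g h φ)

@[simp] lemma comapPoints_toConv (φ : B →ₐc[k] A) (g : A →ₐ[k] R) :
    comapPoints φ (toConv g) = toConv (g.comp (φ : B →ₐ[k] A)) := rfl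

lemma comul_bialgHom_apply (φ : B →ₐc[k] A) (b : B) :
    comul (R := k) (φ b) =
      Algebra.TensorProduct.map (φ : B →ₐ[k] A) (φ : B →ₐ[k] A) (comul (R := k) b) :=
  (CoalgHomClass.map_comp_comul_apply φ b).symm

lemma bialgHom_antipode_apply (φ : B →ₐc[k] A) (b : B) :
    φ (HopfAlgebra.antipode k b) = HopfAlgebra.antipode k (φ b) :=
  (AlgHom.congr_fun (congrArg ofConv (map_inv (comapPoints φ) (toConv (AlgHom.id k A)))) b).symm

lemma isCentral_iff_commute {z : A →ₐ[k] R} :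
    IsCentral z ↔ Commute (toConv includeLeft) (toConv (includeRight.comp z)) := Iff.rfl

lemma IsCentral.commute {z : A →ₐ[k] R} (hz : IsCentral z) (f : R →ₐ[k] T) (g : A →ₐ[k] T) :
    Commute (toConv g) (toConv (f.comp z)) := by
  have hgf := (isCentral_iff_commute.1 hz).map (mapPoints (lift g f fun _ _ => Commute.all _ _))
  rwa [mapPoints_toConv, mapPoints_toConv, lift_comp_includeLeft, ← AlgHom.comp_assoc,
    show (lift g f fun _ _ => Commute.all _ _).comp includeRight = f from
      lift_comp_includeRight g f fun _ _ => Commute.all _ _] at hgf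

end Points

section HopfIdeal

open Coalgebra

variable {k : Type*} [Field k] {A B : Type*} [CommRing A] [HopfAlgebra k A] [CommRing B]
  [HopfAlgebra k B]

lemma map_mkₐ_comul_eq_zero (I : Ideal A) [I.IsHopfIdeal k] {a : A} (ha : a ∈ I) :
    Algebra.TensorProduct.map (Ideal.Quotient.mkₐ k I) (Ideal.Quotient.mkₐ k I)
      (comul (R := k) a) = 0 :=
  Submodule.IsCoideal.map_mkQ_comul_eq_zero (R := k) (I := I.restrictScalars k) ha

lemma isHopfIdeal_map (φ : B →ₐc[k] A) (I : Ideal B) [I.IsHopfIdeal k] :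
    (I.map φ).IsHopfIdeal k where
  counit_eq_zero := by
    have hle : I.map φ ≤ RingHom.ker (Bialgebra.counitAlgHom k A) :=
      Ideal.map_le_iff_le_comap.2 fun b hb =>
        (CoalgHomClass.counit_comp_apply φ b).trans
          (Submodule.IsCoideal.counit_eq_zero (R := k) (I := I.restrictScalars k) hb)
    exact fun a ha => hle ha
  map_mkQ_comul_eq_zero := by
    let j : B ⧸ I →ₐ[k] A ⧸ I.map φ := Ideal.quotientMapₐ _ (φ : B →ₐ[k] A) Ideal.le_comap_map
    have hle : I.map φ ≤ RingHom.ker ((Algebra.TensorProduct.map (Ideal.Quotient.mkₐ k (I.map φ))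
        (Ideal.Quotient.mkₐ k (I.map φ))).comp (Bialgebra.comulAlgHom k A)) := by
      refine Ideal.map_le_iff_le_comap.2 fun b hb => ?_
      have hj := congrArg (Algebra.TensorProduct.map j j) (map_mkₐ_comul_eq_zero I hb)
      rw [map_zero, ← AlgHom.comp_apply, ← Algebra.TensorProduct.map_comp] at hj
      rw [Ideal.mem_comap, RingHom.mem_ker, AlgHom.comp_apply, Bialgebra.comulAlgHom_apply,
        comul_bialgHom_apply, ← AlgHom.comp_apply, ← Algebra.TensorProduct.map_comp]
      exact hj
    exact fun a ha => hle ha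
  antipode_mem := by
    have hle : I.map φ ≤ (I.map φ).comap (HopfAlgebra.antipodeAlgHom k A) := by
      refine Ideal.map_le_iff_le_comap.2 fun b hb => ?_
      change HopfAlgebra.antipode k (φ b) ∈ I.map φ
      rw [← bialgHom_antipode_apply]
      exact Ideal.mem_map_of_mem φ (Ideal.IsHopfIdeal.antipode_mem hb)
    exact fun a ha => hle ha

lemma isHopfIdeal_comap (φ : B →ₐc[k] A) (I : Ideal A) [I.IsHopfIdeal k] :
    (I.comap φ).IsHopfIdeal k where
  counit_eq_zero b hb :=
    (CoalgHomClass.counit_comp_apply φ b).symm.trans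
      (Submodule.IsCoideal.counit_eq_zero (R := k) (I := I.restrictScalars k) hb)
  map_mkQ_comul_eq_zero b hb := by
    let j : B ⧸ I.comap φ →ₐ[k] A ⧸ I := Ideal.quotientMapₐ I (φ : B →ₐ[k] A) le_rfl
    have hj : Function.Injective j :=
      Ideal.quotientMap_injective (I := I) (f := (φ : B →ₐ[k] A).toRingHom)
    have hjj : Function.Injective (Algebra.TensorProduct.map j j) :=
      TensorProduct.map_injective_of_flat_flat j.toLinearMap j.toLinearMap hj hj
    have hb' := map_mkₐ_comul_eq_zero (k := k) I (Ideal.mem_comap.1 hb)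
    rw [comul_bialgHom_apply, ← AlgHom.comp_apply, ← Algebra.TensorProduct.map_comp] at hb'
    refine (map_eq_zero_iff _ hjj).1 (Eq.trans ?_ hb')
    change Algebra.TensorProduct.map j j (Algebra.TensorProduct.map
      (Ideal.Quotient.mkₐ k (I.comap φ)) (Ideal.Quotient.mkₐ k (I.comap φ)) _) = _
    rw [← AlgHom.comp_apply, ← Algebra.TensorProduct.map_comp]
    rfl
  antipode_mem b hb :=
    Ideal.mem_comap.2 <| (bialgHom_antipode_apply φ b).symm ▸
      Ideal.IsHopfIdeal.antipode_mem (Ideal.mem_comap.1 hb)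

/-- The factorisation through the closed subgroup `V(I)` of a homomorphism of affine groups whose
comorphism `φ` vanishes on the Hopf ideal `I`. -/
def quotientLift (I : Ideal B) [I.IsHopfIdeal k] (φ : B →ₐc[k] A) (hφ : ∀ b ∈ I, φ b = 0) :
    B ⧸ I →ₐc[k] A :=
  .ofAlgHom (Ideal.Quotient.liftₐ I (φ : B →ₐ[k] A) hφ)
    (Ideal.Quotient.algHom_ext k (AlgHom.ext fun b => CoalgHomClass.counit_comp_apply φ b))
    (by
      refine Ideal.Quotient.algHom_ext k (AlgHom.ext fun b => ?_)
      change Algebra.TensorProduct.map _ _ (Algebra.TensorProduct.map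
        (Ideal.Quotient.mkₐ k I) (Ideal.Quotient.mkₐ k I) (comul (R := k) b)) =
          comul (R := k) (φ b)
      rw [← AlgHom.comp_apply, ← Algebra.TensorProduct.map_comp, comul_bialgHom_apply]
      rfl)

lemma quotientLift_injective (I : Ideal B) [I.IsHopfIdeal k] (φ : B →ₐc[k] A)
    (hφ : ∀ b, b ∈ I ↔ φ b = 0) :
    Function.Injective (quotientLift I φ fun b => (hφ b).1) := by
  rw [injective_iff_map_eq_zero]
  intro b hb
  obtain ⟨b, rfl⟩ := Ideal.Quotient.mk_surjective b
  exact Ideal.Quotient.eq_zero_iff_mem.2 ((hφ b).2 hb)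

end HopfIdeal

section Slice

open WithConv Algebra.TensorProduct Coalgebra

variable {k : Type*} [Field k]

section

variable {V V' W : Type*} [AddCommGroup V] [Module k V] [AddCommGroup V'] [Module k V']
  [AddCommGroup W] [Module k W]

/-- The contraction of the second factor of a tensor by a linear form. When `l` is the evaluation
at a point `g`, `slice l (comul f)` is the translate `f (· g)` of a function `f`. -/
def slice (l : W →ₗ[k] k) : V ⊗[k] W →ₗ[k] V :=
  (TensorProduct.rid k V).toLinearMap ∘ₗ l.lTensor V

@[simp] lemma slice_tmul (l : W →ₗ[k] k) (x : V) (y : W) : slice l (x ⊗ₜ y) = l y • x := by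
  simp [slice]

lemma slice_rTensor (l : W →ₗ[k] k) (f : V →ₗ[k] V') (t : V ⊗[k] W) :
    slice l (f.rTensor W t) = f (slice l t) := by
  have h : slice l ∘ₗ f.rTensor W = f ∘ₗ slice l := TensorProduct.ext' fun x y => by simp
  exact LinearMap.congr_fun h t

lemma exists_eq_sum_slice_tmul {W : Type w} [AddCommGroup W] [Module k W] (t : V ⊗[k] W) :
    ∃ (κ : Type w) (s : Finset κ) (l : κ → W →ₗ[k] k) (y : κ → W),
      t = ∑ i ∈ s, slice (l i) t ⊗ₜ y i := by
  classical
  let b := Module.Basis.ofVectorSpace k W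
  obtain ⟨c, rfl⟩ := TensorProduct.eq_repr_basis_right b t
  refine ⟨_, c.support, b.coord, b, Finset.sum_congr rfl fun i _ => ?_⟩
  congr 1
  simp [Finsupp.sum, Finsupp.single_apply]

end

variable {A : Type u} [CommRing A] [HopfAlgebra k A]

lemma comul_slice_comul (l : A →ₗ[k] k) (a : A) :
    comul (R := k) (slice l (comul (R := k) a)) =
      (slice l ∘ₗ comul).lTensor A (comul (R := k) a) := by
  have h : (slice l : (A ⊗[k] A) ⊗[k] A →ₗ[k] A ⊗[k] A) =
      (slice l).lTensor A ∘ₗ (TensorProduct.assoc k A A A).toLinearMap :=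
    TensorProduct.ext_threefold fun x y z => by simp
  rw [← slice_rTensor, h, LinearMap.comp_apply, LinearEquiv.coe_coe, coassoc_apply,
    LinearMap.lTensor_comp_apply]

lemma counit_slice_comul (l : A →ₗ[k] k) (a : A) :
    counit (R := k) (slice l (comul (R := k) a)) = l a := by
  rw [← slice_rTensor, rTensor_counit_comul, slice_tmul, smul_eq_mul, mul_one]

lemma slice_counit_comul (a : A) : slice counit (comul (R := k) a) = a := by
  rw [slice, LinearMap.comp_apply, lTensor_counit_comul]
  simp

/-- Stability of a set of functions on an affine group under translation. -/
def IsTranslationStable (k : Type*) [Field k] {A : Type*} [CommRing A] [HopfAlgebra k A]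
    (U : Set A) : Prop :=
  ∀ a ∈ U, ∀ l : A →ₗ[k] k, slice l (comul (R := k) a) ∈ U

/-- The space of translates of a function on an affine group. -/
def translates (k : Type*) [Field k] {A : Type*} [CommRing A] [HopfAlgebra k A] (a : A) :
    Submodule k A where
  carrier := {x | ∃ l : A →ₗ[k] k, slice l (comul (R := k) a) = x}
  add_mem' := by
    rintro _ _ ⟨l, rfl⟩ ⟨m, rfl⟩
    exact ⟨l + m, by simp [slice, LinearMap.lTensor_add]⟩
  zero_mem' := ⟨0, by simp [slice]⟩
  smul_mem' := by
    rintro c _ ⟨l, rfl⟩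
    exact ⟨c • l, by simp [slice, LinearMap.lTensor_smul]⟩

lemma self_mem_translates (a : A) : a ∈ translates k a := ⟨counit, slice_counit_comul a⟩

lemma isTranslationStable_translates (a : A) :
    IsTranslationStable k (translates k a : Set A) := by
  rintro _ ⟨l, rfl⟩ m
  have h : ∀ t : A ⊗[k] A, slice m ((slice l ∘ₗ comul (R := k)).lTensor A t) =
      slice (m ∘ₗ slice l ∘ₗ comul) t := fun t => by
    simp only [slice, LinearMap.comp_apply, ← LinearMap.lTensor_comp_apply]
  exact ⟨m ∘ₗ slice l ∘ₗ comul, by rw [comul_slice_comul, h]⟩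

instance finite_translates (a : A) : Module.Finite k (translates k a) := by
  obtain ⟨κ, s, l, y, h⟩ := exists_eq_sum_slice_tmul (comul (R := k) a)
  have hle : translates k a ≤
      Submodule.span k ((fun i => slice (l i) (comul (R := k) a)) '' (s : Set κ)) := by
    rintro _ ⟨m, rfl⟩
    rw [h, map_sum]
    refine Submodule.sum_mem _ fun i hi => ?_
    rw [slice_tmul]
    exact Submodule.smul_mem _ _ (Submodule.subset_span ⟨i, hi, by rw [← h]⟩)
  have := Module.Finite.span_of_finite k
    (s.finite_toSet.image fun i => slice (l i) (comul (R := k) a))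
  exact Submodule.finiteDimensional_of_le hle

/-- A nonzero ideal contains a function with nonzero value at the identity after translation;
expanding `f(1) = ∑ f₁ S(f₂)` puts that value in the ideal. -/
lemma IsTranslationStable.ideal_eq_top {I : Ideal A} (h : IsTranslationStable k (I : Set A))
    (hI : I ≠ ⊥) : I = ⊤ := by
  obtain ⟨b, hb, hb0⟩ := Submodule.exists_mem_ne_zero_of_ne_bot hI
  obtain ⟨l, hl⟩ : ∃ l : A →ₗ[k] k, l b ≠ 0 := by
    by_contra! hl
    exact hb0 ((Module.forall_dual_apply_eq_zero_iff k b).1 hl)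
  obtain ⟨κ, s, m, y, hsum⟩ := exists_eq_sum_slice_tmul
    (comul (R := k) (slice l (comul (R := k) b)))
  have hmem : algebraMap k A (l b) ∈ I := by
    rw [← counit_slice_comul, ← HopfAlgebra.mul_antipode_lTensor_comul_apply, hsum, map_sum,
      map_sum]
    refine I.sum_mem fun i _ => ?_
    rw [LinearMap.lTensor_tmul, LinearMap.mul'_apply]
    exact I.mul_mem_right _ (h _ (h b hb l) (m i))
  exact I.eq_top_of_isUnit_mem hmem ((isUnit_iff_ne_zero.2 hl).map (algebraMap k A))

lemma toConv_includeLeft_mul_includeRight :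
    (toConv includeLeft * toConv includeRight : WithConv (A →ₐ[k] A ⊗[k] A)) =
      toConv (Bialgebra.comulAlgHom k A) := by
  refine ofConv_injective (AlgHom.ext fun a => (conv_left_right (AlgHom.id k A) a).trans ?_)
  simp

/-- The function `(g, h) ↦ a(g h h⁻¹)`. -/
lemma sum_comul_mul_antipode {κ : Type*} {s : Finset κ} {x y : κ → A} {a : A}
    (h : comul (R := k) a = ∑ i ∈ s, x i ⊗ₜ y i) :
    ∑ i ∈ s, comul (R := k) (x i) * (1 ⊗ₜ HopfAlgebra.antipode k (y i)) = a ⊗ₜ 1 := by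
  have hgroup : toConv (Bialgebra.comulAlgHom k A) *
      (toConv (includeRight : A →ₐ[k] A ⊗[k] A))⁻¹ = toConv includeLeft := by
    rw [← toConv_includeLeft_mul_includeRight, mul_inv_cancel_right]
  have happly := AlgHom.congr_fun (congrArg ofConv hgroup) a
  rw [AlgHom.convMul_apply, h, map_sum] at happly
  exact happly

end Slice

section Descent

open Algebra.TensorProduct Coalgebra

/-- The function `f` takes the same value at any two points which have the same image under the
map of affine schemes with comorphism `ι`. -/
def IsEqualized {k : Type v} [Field k] {B E : Type u} [CommRing B] [Algebra k B] [CommRing E]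
    [Algebra k E] (ι : B →ₐ[k] E) (f : E) : Prop :=
  ∀ (T : Type u) [CommRing T] [Algebra k T] (u v : E →ₐ[k] T), u.comp ι = v.comp ι → u f = v f

section

variable {k : Type v} [Field k] {B E : Type u} [CommRing B] [Algebra k B] [CommRing E]
  [Algebra k E] {ι : B →ₐ[k] E} {f : E}

lemma IsEqualized.ringHom_apply_eq (hf : IsEqualized ι f) {T : Type u} [CommRing T]
    (u v : E →+* T) (huv : ∀ b, u (ι b) = v (ι b)) : u f = v f := by
  let : Algebra k T := (u.comp (algebraMap k E)).toAlgebra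
  have hv : ∀ c, v (algebraMap k E c) = u (algebraMap k E c) := fun c => by
    rw [← ι.commutes, huv]
  exact hf T { u with commutes' := fun _ => rfl } { v with commutes' := hv } (AlgHom.ext huv)

/-- Over the fraction field of `B` the map `ι` becomes faithfully flat, so that `f` descends. -/
lemma IsEqualized.exists_ne_zero_mul_mem_range [IsDomain B] (hf : IsEqualized ι f) :
    ∃ s : B, s ≠ 0 ∧ ι s * f ∈ ι.range := by
  let : Algebra B E := ι.toRingHom.toAlgebra
  let K := FractionRing B
  let j : E →ₐ[B] K ⊗[B] E := includeRight
  have hj : ∀ b : B, j (ι b) = algebraMap K (K ⊗[B] E) (algebraMap B K b) := fun b =>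
    (j.commutes b).trans (IsScalarTower.algebraMap_apply B K (K ⊗[B] E) b)
  obtain ⟨q, hq⟩ : j f ∈ Set.range (algebraMap K (K ⊗[B] E)) := by
    rcases subsingleton_or_nontrivial (K ⊗[B] E) with _ | _
    · exact ⟨0, Subsingleton.elim _ _⟩
    let inl : K ⊗[B] E →ₐ[K] (K ⊗[B] E) ⊗[K] (K ⊗[B] E) := includeLeft
    let inr : K ⊗[B] E →ₐ[K] (K ⊗[B] E) ⊗[K] (K ⊗[B] E) := includeRight
    have hinl : ∀ b, inl (j (ι b)) = inr (j (ι b)) := fun b => by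
      rw [hj, AlgHom.commutes, AlgHom.commutes]
    have hf' : inl (j f) = inr (j f) :=
      hf.ringHom_apply_eq (T := (K ⊗[B] E) ⊗[K] (K ⊗[B] E))
        (inl.toRingHom.comp j.toRingHom) (inr.toRingHom.comp j.toRingHom) hinl
    exact (Algebra.IsEffective.of_faithfullyFlat K (K ⊗[B] E) _).1 (sub_eq_zero.2 hf')
  obtain ⟨b, s, hs, rfl⟩ := IsFractionRing.div_surjective (A := B) q
  have hs0 : algebraMap B K s ≠ 0 := IsFractionRing.to_map_ne_zero_of_mem_nonZeroDivisors hs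
  have hfrac : j (ι s * f) = j (ι b) := by
    rw [map_mul, hj, hj, ← hq, ← map_mul, mul_div_cancel₀ _ hs0]
  obtain ⟨c, hc⟩ := (IsLocalizedModule.eq_iff_exists (nonZeroDivisors B)
    (TensorProduct.mk B K E 1)).1 hfrac
  refine ⟨c * s, mul_ne_zero (nonZeroDivisors.coe_ne_zero c) (nonZeroDivisors.ne_zero hs),
    c * b, ?_⟩
  change ι (c * b) = _
  rw [map_mul, map_mul, mul_assoc]
  exact hc.symm

end

variable {k : Type v} [Field k] {B E : Type u} [CommRing B] [HopfAlgebra k B] [CommRing E]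
  [HopfAlgebra k E]

lemma IsEqualized.slice_comul {ι : B →ₐc[k] E} {f : E} (hf : IsEqualized (ι : B →ₐ[k] E) f)
    (l : E →ₗ[k] k) : IsEqualized (ι : B →ₐ[k] E) (slice l (comul (R := k) f)) := by
  intro T _ _ u v huv
  let translate (w : E →ₐ[k] T) : E →ₐ[k] T ⊗[k] E :=
    (Algebra.TensorProduct.map w (AlgHom.id k E)).comp (Bialgebra.comulAlgHom k E)
  have htranslate (w : E →ₐ[k] T) (b : B) : translate w (ι b) =
      Algebra.TensorProduct.map (w.comp (ι : B →ₐ[k] E)) (ι : B →ₐ[k] E)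
        (comul (R := k) b) := by
    change Algebra.TensorProduct.map w (AlgHom.id k E) (comul (R := k) (ι b)) = _
    rw [comul_bialgHom_apply, ← AlgHom.comp_apply, ← Algebra.TensorProduct.map_comp,
      AlgHom.id_comp]
  have h : translate u f = translate v f := hf _ _ _ <| AlgHom.ext fun b =>
    (htranslate u b).trans (huv ▸ (htranslate v b).symm)
  have hslice (w : E →ₐ[k] T) : w (slice l (comul (R := k) f)) = slice l (translate w f) :=
    (slice_rTensor l w.toLinearMap (comul (R := k) f)).symm
  rw [hslice, hslice, h]

/-- The ideal of common denominators in `B` of the functions in `U`. -/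
def denominatorIdeal (ι : B →ₐc[k] E) (U : Submodule k E) : Ideal B where
  carrier := {b | ∀ x ∈ U, ι b * x ∈ (ι : B →ₐ[k] E).range}
  add_mem' {a b} ha hb x hx := by
    rw [map_add, add_mul]
    exact add_mem (ha x hx) (hb x hx)
  zero_mem' x _ := by
    rw [map_zero, zero_mul]
    exact zero_mem _
  smul_mem' c b hb x hx := by
    rw [smul_eq_mul, map_mul, mul_assoc]
    exact mul_mem ⟨c, rfl⟩ (hb x hx)

lemma denominatorIdeal_ne_bot [IsDomain B] (ι : B →ₐc[k] E) (U : Submodule k E)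
    [Module.Finite k U] (hU : ∀ x ∈ U, ∃ s : B, s ≠ 0 ∧ ι s * x ∈ (ι : B →ₐ[k] E).range) :
    denominatorIdeal ι U ≠ ⊥ := by
  obtain ⟨S, rfl⟩ := Module.Finite.iff_fg.1 ‹Module.Finite k U›
  choose! s hs0 hs using fun x (hx : x ∈ S) => hU x (Submodule.subset_span hx)
  refine (Submodule.ne_bot_iff _).2 ⟨∏ x ∈ S, s x, fun x hx => ?_, Finset.prod_ne_zero_iff.2 hs0⟩
  induction hx using Submodule.span_induction with
  | mem x hx =>
    obtain ⟨c, hc⟩ := Finset.dvd_prod_of_mem s hx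
    rw [hc, mul_comm (s x), map_mul, mul_assoc]
    exact (ι : B →ₐ[k] E).range.mul_mem ⟨c, rfl⟩ (hs x hx)
  | zero => simp
  | add x y _ _ hx hy => simpa only [mul_add] using add_mem hx hy
  | smul c x _ hx => simpa only [mul_smul_comm] using Subalgebra.smul_mem _ hx c

/-- If `ι b` clears the denominators of `x₁` for every `x₁` in `U`, then `Δ(b x₁)` has components
in `B`; summing against `S(x₂)` and using `∑ Δ(x₁) (1 ⊗ S(x₂)) = x ⊗ 1` shows that so do the
translates of `b` times `x`. -/
lemma isTranslationStable_denominatorIdeal {ι : B →ₐc[k] E} (hι : Function.Injective ι)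
    {U : Submodule k E} (hU : IsTranslationStable k (U : Set E)) :
    IsTranslationStable k (denominatorIdeal ι U : Set B) := by
  intro b hb l x hx
  obtain ⟨p, hp⟩ := LinearMap.exists_leftInverse_of_injective
    (ι : B →ₐ[k] E).toLinearMap (LinearMap.ker_eq_bot.2 hι)
  have hpι : ∀ c, p (ι c) = c := LinearMap.congr_fun hp
  let ιι := Algebra.TensorProduct.map (ι : B →ₐ[k] E) (ι : B →ₐ[k] E)
  have hslice : ∀ t : B ⊗[k] B,
      ι (slice l t) * x = slice (l ∘ₗ p) (ιι t * (x ⊗ₜ 1)) := by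
    intro t
    induction t using TensorProduct.induction_on with
    | zero => simp
    | tmul c d => simp [ιι, hpι]
    | add t t' ht ht' => simp only [map_add, add_mul, ht, ht']
  have hrange : ∀ (r : E) (t : B ⊗[k] B),
      slice (l ∘ₗ p) (ιι t * (1 ⊗ₜ r)) ∈ (ι : B →ₐ[k] E).range := by
    intro r t
    induction t using TensorProduct.induction_on with
    | zero => simp
    | tmul c d =>
      rw [map_tmul, tmul_mul_tmul, mul_one, slice_tmul]
      exact (ι : B →ₐ[k] E).range.smul_mem ⟨c, rfl⟩ _
    | add t t' ht ht' => simpa only [map_add, add_mul] using add_mem ht ht'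
  obtain ⟨κ, s, m, y, hsum⟩ := exists_eq_sum_slice_tmul (comul (R := k) x)
  rw [hslice, ← comul_bialgHom_apply, ← sum_comul_mul_antipode hsum, Finset.mul_sum, map_sum]
  refine sum_mem fun i _ => ?_
  obtain ⟨c, hc⟩ := hb _ (hU x hx (m i))
  rw [← mul_assoc, ← Bialgebra.comul_mul, ← hc]
  exact (comul_bialgHom_apply ι c).symm ▸ hrange _ _

theorem mem_range_of_isEqualized [IsDomain B] {ι : B →ₐc[k] E} (hι : Function.Injective ι) {f : E}
    (hf : IsEqualized (ι : B →ₐ[k] E) f) : f ∈ (ι : B →ₐ[k] E).range := by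
  have hne : denominatorIdeal ι (translates k f) ≠ ⊥ := by
    refine denominatorIdeal_ne_bot ι _ ?_
    rintro _ ⟨l, rfl⟩
    exact (hf.slice_comul l).exists_ne_zero_mul_mem_range
  have hone : (1 : B) ∈ denominatorIdeal ι (translates k f) :=
    (isTranslationStable_denominatorIdeal hι (isTranslationStable_translates f)).ideal_eq_top hne ▸
      Submodule.mem_top
  simpa using hone f (self_mem_translates f)

end Descent

section AdjointGroup

open WithConv Algebra.TensorProduct Coalgebra

lemma conj_mul_eq_of_commute {G : Type*} [Group G] {x y z : G} (h : Commute y z) :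
    x * y * z * (x * y)⁻¹ = x * z * x⁻¹ := by
  rw [mul_assoc x y z, h.eq]
  group

section

variable {k : Type v} [Field k] {A : Type u} [CommRing A] [HopfAlgebra k A] {R : Type*}
  [CommRing R] [Algebra k R]

lemma toConv_conjugation : toConv (conjugation k A) =
    (toConv includeRight * toConv includeLeft * (toConv includeRight)⁻¹ :
      WithConv (A →ₐ[k] A ⊗[k] A)) := rfl

lemma mapPoints_conjugation {T : Type*} [CommRing T] [Algebra k T] (F : A ⊗[k] A →ₐ[k] T) :
    mapPoints F (toConv (conjugation k A)) = toConv (F.comp includeRight) *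
      toConv (F.comp includeLeft) * (toConv (F.comp includeRight))⁻¹ := by
  rw [toConv_conjugation, map_mul, map_mul, map_inv, mapPoints_toConv, mapPoints_toConv]

lemma IsCentral.mapPoints_conjugation_eq {z : A →ₐ[k] R} (hz : IsCentral z) {T : Type*}
    [CommRing T] [Algebra k T] (f : R →ₐ[k] T) {F G : A ⊗[k] A →ₐ[k] T}
    (hl : F.comp includeLeft = G.comp includeLeft)
    (hr : toConv (F.comp includeRight) = toConv (G.comp includeRight) * toConv (f.comp z)) :
    mapPoints F (toConv (conjugation k A)) = mapPoints G (toConv (conjugation k A)) := by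
  rw [mapPoints_conjugation, mapPoints_conjugation, hr, hl]
  exact conj_mul_eq_of_commute (hz.commute f _).symm

lemma apply_lid_rTensor (g : A →ₐ[k] R) (l : A →ₗ[k] k) (t : A ⊗[k] A) :
    g (TensorProduct.lid k A (l.rTensor A t)) = TensorProduct.lid k R
      (l.rTensor R (Algebra.TensorProduct.map (AlgHom.id k A) g t)) := by
  induction t using TensorProduct.induction_on with
  | zero => simp
  | tmul x y => simp
  | add x y hx hy => simp only [map_add, hx, hy]

/-- The matrix coefficients of the conjugation action of `G` on `O(G)` are functions on `G^ad`. -/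
lemma lid_rTensor_conjugation_mem (a : A) (l : A →ₗ[k] k) :
    TensorProduct.lid k A (l.rTensor A (conjugation k A a)) ∈ adjointSubalgebra k A := by
  intro R _ _ z hz
  let gz : WithConv (A →ₐ[k] A ⊗[k] R) := toConv includeLeft * toConv (includeRight.comp z)
  have hconj : mapPoints (Algebra.TensorProduct.map (AlgHom.id k A) gz.ofConv)
        (toConv (conjugation k A)) =
      mapPoints (Algebra.TensorProduct.map (AlgHom.id k A) includeLeft)
        (toConv (conjugation k A)) := by
    refine hz.mapPoints_conjugation_eq (includeRight.comp includeRight) ?_ ?_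
    · rw [map_comp_includeLeft, map_comp_includeLeft]
    · rw [map_comp_includeRight, map_comp_includeRight]
      exact map_mul (mapPoints (A := A) (includeRight : A ⊗[k] R →ₐ[k] A ⊗[k] (A ⊗[k] R)))
        (toConv includeLeft) (toConv (includeRight.comp z))
  have happly := AlgHom.congr_fun (congrArg ofConv hconj) a
  refine (apply_lid_rTensor gz.ofConv l _).trans (Eq.trans ?_
    (apply_lid_rTensor (includeLeft : A →ₐ[k] A ⊗[k] R) l (conjugation k A a)).symm)
  exact congrArg (fun t => TensorProduct.lid k _ (l.rTensor _ t)) happly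

/-- The kernel of `G → G^ad` is central: by `lid_rTensor_conjugation_mem` the conjugation by a point
depends only on its image in `G^ad`. -/
lemma isCentral_of_comapPoints_toAdjoint_eq_one {z : WithConv (A →ₐ[k] R)}
    (hz : comapPoints (toAdjoint k A) z = 1) : IsCentral z.ofConv := by
  have hconj : mapPoints (Algebra.TensorProduct.map (AlgHom.id k A) z.ofConv)
        (toConv (conjugation k A)) =
      mapPoints (Algebra.TensorProduct.map (AlgHom.id k A) (ofConv 1))
        (toConv (conjugation k A)) := by
    refine ofConv_injective (AlgHom.ext fun a => eq_of_leftSlice fun l => ?_)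
    have hz' : comapPoints (toAdjoint k A) z = comapPoints (toAdjoint k A) 1 := by
      rw [hz, map_one]
    have happly := AlgHom.congr_fun (congrArg ofConv hz') ⟨_, lid_rTensor_conjugation_mem a l⟩
    exact (apply_lid_rTensor z.ofConv l _).symm.trans
      (happly.trans (apply_lid_rTensor (ofConv 1) l _))
  have hone : toConv ((includeRight : R →ₐ[k] A ⊗[k] R).comp
      (ofConv (1 : WithConv (A →ₐ[k] R)))) = 1 :=
    map_one (mapPoints (A := A) (includeRight : R →ₐ[k] A ⊗[k] R))
  simp only [mapPoints_conjugation, map_comp_includeRight, map_comp_includeLeft, AlgHom.comp_id]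
    at hconj
  rw [hone, one_mul, inv_one, mul_one, mul_inv_eq_iff_eq_mul] at hconj
  exact isCentral_iff_commute.2 hconj.symm

end

section

variable {k : Type*} [Field k] {A B R : Type*} [CommRing A] [HopfAlgebra k A] [CommRing B]
  [HopfAlgebra k B] [CommRing R] [Algebra k R]

lemma comapPoints_includeLeft (φ : B →ₐc[k] A) :
    comapPoints φ (toConv (includeLeft : A →ₐ[k] A ⊗[k] R)) =
      mapPoints (Algebra.TensorProduct.map (φ : B →ₐ[k] A) (AlgHom.id k R))
        (toConv includeLeft) := by
  rw [mapPoints_toConv, comapPoints_toConv, map_comp_includeLeft]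

lemma comapPoints_includeRight_comp (φ : B →ₐc[k] A) (z : A →ₐ[k] R) :
    comapPoints φ (toConv ((includeRight : R →ₐ[k] A ⊗[k] R).comp z)) =
      mapPoints (Algebra.TensorProduct.map (φ : B →ₐ[k] A) (AlgHom.id k R))
        (toConv (includeRight.comp (z.comp (φ : B →ₐ[k] A)))) := by
  rw [mapPoints_toConv, comapPoints_toConv, ← AlgHom.comp_assoc, map_comp_includeRight,
    AlgHom.comp_id, AlgHom.comp_assoc]

lemma IsCentral.commute_comapPoints {φ : B →ₐc[k] A} {z : A →ₐ[k] R}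
    (hz : IsCentral (z.comp (φ : B →ₐ[k] A))) :
    Commute (comapPoints φ (toConv includeLeft))
      (comapPoints φ (toConv ((includeRight : R →ₐ[k] A ⊗[k] R).comp z))) := by
  rw [comapPoints_includeLeft, comapPoints_includeRight_comp]
  exact (isCentral_iff_commute.1 hz).map _

/-- Injectivity of the comorphism is surjectivity of the homomorphism of groups. -/
lemma IsCentral.comp_of_injective {φ : B →ₐc[k] A} (hφ : Function.Injective φ) {z : A →ₐ[k] R}
    (hz : IsCentral z) : IsCentral (z.comp (φ : B →ₐ[k] A)) := by
  let φR : B ⊗[k] R →ₐ[k] A ⊗[k] R := Algebra.TensorProduct.map (φ : B →ₐ[k] A) (AlgHom.id k R)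
  have hφR : Function.Injective φR :=
    TensorProduct.map_injective_of_flat_flat (φ : B →ₐ[k] A).toLinearMap
      (AlgHom.id k R).toLinearMap hφ Function.injective_id
  have hmap : Function.Injective (mapPoints (A := B) φR) := fun g h hgh =>
    ofConv_injective (AlgHom.ext fun b => hφR (AlgHom.congr_fun (congrArg ofConv hgh) b))
  have hcomm := (isCentral_iff_commute.1 hz).map (comapPoints φ)
  rw [comapPoints_includeLeft, comapPoints_includeRight_comp] at hcomm
  exact isCentral_iff_commute.2 (hcomm.of_map hmap)

end

variable {k : Type v} [Field k] {A B : Type u} [CommRing A] [HopfAlgebra k A] [CommRing B]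
  [HopfAlgebra k B]

lemma apply_mul_of_mem_adjointSubalgebra {R : Type u} [CommRing R] [Algebra k R] {z : A →ₐ[k] R}
    (hz : IsCentral z) {T : Type*} [CommRing T] [Algebra k T] (f : R →ₐ[k] T) (g : A →ₐ[k] T)
    {a : A} (ha : a ∈ adjointSubalgebra k A) :
    (toConv g * toConv (f.comp z)).ofConv a = g a := by
  let gf : A ⊗[k] R →ₐ[k] T := lift g f fun _ _ => Commute.all _ _
  have hgf : mapPoints gf (toConv includeLeft * toConv (includeRight.comp z)) =
      toConv g * toConv (f.comp z) := by
    rw [map_mul, mapPoints_toConv, mapPoints_toConv, ← AlgHom.comp_assoc]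
    congr 2
    · exact lift_comp_includeLeft g f fun _ _ => Commute.all _ _
    · exact congrArg (AlgHom.comp · z) (lift_comp_includeRight g f fun _ _ => Commute.all _ _)
  rw [← hgf]
  refine (congrArg gf (ha R z hz)).trans ?_
  simp [gf]

lemma map_mem_adjointSubalgebra {φ : B →ₐc[k] A} (hφ : Function.Injective φ) {b : B}
    (hb : b ∈ adjointSubalgebra k B) : φ b ∈ adjointSubalgebra k A := by
  intro R _ _ z hz
  let φR : B ⊗[k] R →ₐ[k] A ⊗[k] R := Algebra.TensorProduct.map (φ : B →ₐ[k] A) (AlgHom.id k R)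
  have hmul : comapPoints φ (toConv includeLeft * toConv (includeRight.comp z)) =
      mapPoints φR (toConv includeLeft * toConv (includeRight.comp (z.comp (φ : B →ₐ[k] A)))) := by
    rw [map_mul, map_mul, comapPoints_includeLeft, comapPoints_includeRight_comp]
  refine (AlgHom.congr_fun (congrArg ofConv hmul) b).trans ?_
  refine (congrArg φR (hb R _ (hz.comp_of_injective hφ))).trans ?_
  simp [φR]

/-- The homomorphism of adjoint groups induced by a homomorphism of affine groups whose comorphism
is injective, that is, by a surjective homomorphism. -/
def adjointMap (φ : B →ₐc[k] A) (hφ : Function.Injective φ) :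
    AdjointRing k B →ₐc[k] AdjointRing k A :=
  .ofAlgHom (((φ : B →ₐ[k] A).comp (adjointSubalgebra k B).val).codRestrict _
      fun f => map_mem_adjointSubalgebra hφ f.2)
    (AlgHom.ext fun f => CoalgHomClass.counit_comp_apply φ (f : B))
    (by
      refine AlgHom.ext fun f => tensor_val_injective ?_
      rw [AlgHom.comp_apply, AlgHom.comp_apply, Bialgebra.comulAlgHom_apply,
        Bialgebra.comulAlgHom_apply, map_val_comul, ← AlgHom.comp_apply,
        ← Algebra.TensorProduct.map_comp]
      refine Eq.trans ?_ (comul_bialgHom_apply φ (f : B)).symm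
      rw [← map_val_comul, ← AlgHom.comp_apply, ← Algebra.TensorProduct.map_comp]
      rfl)

@[simp] lemma toAdjoint_adjointMap (φ : B →ₐc[k] A) (hφ : Function.Injective φ)
    (f : AdjointRing k B) : toAdjoint k A (adjointMap φ hφ f) = φ f := rfl

end AdjointGroup

section SubgroupOfProduct

open WithConv Algebra.TensorProduct

section

variable {k : Type*} [Field k] {B₁ B₂ E R : Type*} [CommRing B₁] [HopfAlgebra k B₁] [CommRing B₂]
  [HopfAlgebra k B₂] [CommRing E] [HopfAlgebra k E] [CommRing R] [Algebra k R]

/-- The homomorphism into a product of two affine groups with given components. Its comorphism is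
surjective when it is a closed immersion. -/
def bialgLift (φ₁ : B₁ →ₐc[k] E) (φ₂ : B₂ →ₐc[k] E) : B₁ ⊗[k] B₂ →ₐc[k] E :=
  (Bialgebra.mulBialgHom k E).comp (Bialgebra.TensorProduct.map φ₁ φ₂)

@[simp] lemma bialgLift_tmul (φ₁ : B₁ →ₐc[k] E) (φ₂ : B₂ →ₐc[k] E) (a : B₁) (b : B₂) :
    bialgLift φ₁ φ₂ (a ⊗ₜ b) = φ₁ a * φ₂ b := rfl

variable {p₁ : B₁ →ₐc[k] E} {p₂ : B₂ →ₐc[k] E}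

lemma comapPoints_prod_injective (hp : Function.Surjective (bialgLift p₁ p₂)) :
    Function.Injective ((comapPoints (R := R) p₁).prod (comapPoints p₂)) := by
  intro g h hgh
  obtain ⟨h₁, h₂⟩ := Prod.ext_iff.1 hgh
  have hlift : comapPoints (bialgLift p₁ p₂) g = comapPoints (bialgLift p₁ p₂) h := by
    refine ofConv_injective (Algebra.TensorProduct.ext' fun a b => ?_)
    have ha : g.ofConv (p₁ a) = h.ofConv (p₁ a) := AlgHom.congr_fun (congrArg ofConv h₁) a
    have hb : g.ofConv (p₂ b) = h.ofConv (p₂ b) := AlgHom.congr_fun (congrArg ofConv h₂) b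
    change g.ofConv (p₁ a * p₂ b) = h.ofConv (p₁ a * p₂ b)
    rw [map_mul, map_mul, ha, hb]
  exact ofConv_injective ((AlgHom.cancel_right hp).1 (congrArg ofConv hlift))

lemma isCentral_of_components (hp : Function.Surjective (bialgLift p₁ p₂)) {z : E →ₐ[k] R}
    (h₁ : IsCentral (z.comp (p₁ : B₁ →ₐ[k] E))) (h₂ : IsCentral (z.comp (p₂ : B₂ →ₐ[k] E))) :
    IsCentral z :=
  isCentral_iff_commute.2 <| Commute.of_map (comapPoints_prod_injective hp) <|
    Prod.ext h₁.commute_comapPoints h₂.commute_comapPoints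

end

variable {k : Type v} [Field k]

lemma isCentral_comapPoints_inv_mul {B : Type u} [CommRing B] [HopfAlgebra k B] {E T : Type*}
    [CommRing E] [HopfAlgebra k E] [CommRing T] [Algebra k T] {p : B →ₐc[k] E}
    {g h : WithConv (E →ₐ[k] T)}
    (hgh : comapPoints (p.comp (toAdjoint k B)) g = comapPoints (p.comp (toAdjoint k B)) h) :
    IsCentral (comapPoints p (g⁻¹ * h)).ofConv := by
  refine isCentral_of_comapPoints_toAdjoint_eq_one ?_
  change comapPoints (p.comp (toAdjoint k B)) (g⁻¹ * h) = 1
  rw [map_mul, map_inv, hgh, inv_mul_cancel]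

variable {B₁ B₂ E C : Type u} [CommRing B₁] [HopfAlgebra k B₁] [CommRing B₂] [HopfAlgebra k B₂]
  [CommRing E] [HopfAlgebra k E] [CommRing C] [HopfAlgebra k C]

/-- For a closed subgroup `G` of `G₁ × G₂`, two points `u, v` of `G` with the same image in
`G₁^ad × G₂^ad` differ by a central element, so that they agree on `O(G^ad)`; hence `O(G^ad)`
descends to any Hopf subalgebra which contains the images of `O(G₁^ad)` and `O(G₂^ad)`. -/
theorem adjointSubalgebra_le_range [IsDomain C] {p₁ : B₁ →ₐc[k] E} {p₂ : B₂ →ₐc[k] E}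
    (hp : Function.Surjective (bialgLift p₁ p₂)) {ι : C →ₐc[k] E} (hι : Function.Injective ι)
    (h₁ : ∀ a ∈ adjointSubalgebra k B₁, p₁ a ∈ (ι : C →ₐ[k] E).range)
    (h₂ : ∀ a ∈ adjointSubalgebra k B₂, p₂ a ∈ (ι : C →ₐ[k] E).range) :
    adjointSubalgebra k E ≤ (ι : C →ₐ[k] E).range := by
  refine fun f hf => mem_range_of_isEqualized hι fun T _ _ u v huv => ?_
  have hagree : ∀ x ∈ (ι : C →ₐ[k] E).range, u x = v x := by
    rintro _ ⟨c, rfl⟩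
    exact AlgHom.congr_fun huv c
  have hz : IsCentral ((toConv u)⁻¹ * toConv v).ofConv :=
    isCentral_of_components hp
      (isCentral_comapPoints_inv_mul <| ofConv_injective <| AlgHom.ext fun a =>
        hagree _ (h₁ a a.2))
      (isCentral_comapPoints_inv_mul <| ofConv_injective <| AlgHom.ext fun a =>
        hagree _ (h₂ a a.2))
  have happly := apply_mul_of_mem_adjointSubalgebra hz (AlgHom.id k T) u hf
  rw [AlgHom.id_comp, toConv_ofConv, mul_inv_cancel_left] at happly
  exact happly.symm

end SubgroupOfProduct

namespace DeligneHom

variable {A : Type u} [CommRing A] [HopfAlgebra ℚ A] {B : Type v} [CommRing B] [HopfAlgebra ℚ B]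
  {C : Type w} [CommRing C] [HopfAlgebra ℚ C]

lemma map_one_tmul (φ : B →ₐc[ℚ] A) (h : DeligneHom A) (b : B) :
    h.map φ (1 ⊗ₜ b) = h (1 ⊗ₜ φ b) := rfl

lemma toMumfordTate_one_tmul_mk (h : DeligneHom A) (a : A) :
    h.toMumfordTate (1 ⊗ₜ Ideal.Quotient.mk h.mtIdeal a) = h (1 ⊗ₜ a) :=
  congrArg (fun F : DeligneHom A => F (1 ⊗ₜ a)) h.map_toMumfordTate

lemma ext_one_tmul {h h' : DeligneHom A} (e : ∀ a, h (1 ⊗ₜ a) = h' (1 ⊗ₜ a)) : h = h' :=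
  restrict_injective (AlgHom.ext e)

lemma map_comp (φ : B →ₐc[ℚ] A) (ψ : C →ₐc[ℚ] B) (h : DeligneHom A) :
    h.map (φ.comp ψ) = (h.map φ).map ψ :=
  ext_one_tmul fun _ => rfl

lemma ad_map_adjointMap {A B : Type u} [CommRing A] [HopfAlgebra ℚ A] [CommRing B]
    [HopfAlgebra ℚ B] (φ : B →ₐc[ℚ] A) (hφ : Function.Injective φ) (h : DeligneHom A) :
    h.ad.map (adjointMap φ hφ) = (h.map φ).ad :=
  ext_one_tmul fun _ => rfl

lemma map_bialgLift_eq {A : Type*} [CommRing A] [HopfAlgebra ℚ A] {B : Type*} [CommRing B]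
    [HopfAlgebra ℚ B] {C₁ C₂ : Type u} [CommRing C₁] [HopfAlgebra ℚ C₁] [CommRing C₂]
    [HopfAlgebra ℚ C₂] {h : DeligneHom A} {h' : DeligneHom B} {φ₁ : C₁ →ₐc[ℚ] A}
    {φ₂ : C₂ →ₐc[ℚ] A} {ψ₁ : C₁ →ₐc[ℚ] B} {ψ₂ : C₂ →ₐc[ℚ] B} (e₁ : h.map φ₁ = h'.map ψ₁)
    (e₂ : h.map φ₂ = h'.map ψ₂) :
    h.map (B := C₁ ⊗[ℚ] C₂) (bialgLift φ₁ φ₂) = h'.map (B := C₁ ⊗[ℚ] C₂) (bialgLift ψ₁ ψ₂) := by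
  refine restrict_injective (Algebra.TensorProduct.ext' fun a b => ?_)
  have ha : h.restrict (φ₁ a) = h'.restrict (ψ₁ a) :=
    congrArg (fun F : DeligneHom C₁ => F (1 ⊗ₜ a)) e₁
  have hb : h.restrict (φ₂ b) = h'.restrict (ψ₂ b) :=
    congrArg (fun F : DeligneHom C₂ => F (1 ⊗ₜ b)) e₂
  change h.restrict (φ₁ a * φ₂ b) = h'.restrict (ψ₁ a * ψ₂ b)
  rw [map_mul, map_mul, ha, hb]

/-- The Mumford-Tate group of `φ ∘ h` is the image under `φ` of the Mumford-Tate group of `h`. -/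
lemma mtIdeal_map (φ : B →ₐc[ℚ] A) (h : DeligneHom A) :
    (h.map φ).mtIdeal = h.mtIdeal.comap φ := by
  refine le_antisymm (Ideal.map_le_iff_le_comap.1 (le_sSup ⟨isHopfIdeal_map φ _, ?_⟩))
    (le_sSup ⟨isHopfIdeal_comap φ _, fun b hb => h.mtIdeal_le_ker hb⟩)
  have hle : (h.map φ).mtIdeal.map φ ≤ RingHom.ker h.restrict :=
    Ideal.map_le_iff_le_comap.2 fun b hb => (h.map φ).mtIdeal_le_ker hb
  exact fun a ha => hle ha

lemma mem_mtIdeal_map_iff {h : DeligneHom A} (hh : h.mtIdeal = ⊥) (φ : B →ₐc[ℚ] A) (b : B) :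
    b ∈ (h.map φ).mtIdeal ↔ φ b = 0 := by
  rw [mtIdeal_map, hh, Ideal.mem_comap, Ideal.mem_bot]

lemma mtIdeal_toMumfordTate (h : DeligneHom A) : h.toMumfordTate.mtIdeal = ⊥ := by
  have hcomap := mtIdeal_map (Bialgebra.Quotient.mkBialgHom h.mtIdeal) h.toMumfordTate
  rw [map_toMumfordTate] at hcomap
  refine (Submodule.eq_bot_iff _).2 fun a ha => ?_
  obtain ⟨a, rfl⟩ := Ideal.Quotient.mk_surjective a
  exact Ideal.Quotient.eq_zero_iff_mem.2 (hcomap.ge ha)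

lemma mtIdeal_ad {h : DeligneHom A} (hh : h.mtIdeal = ⊥) : h.ad.mtIdeal = ⊥ :=
  (Submodule.eq_bot_iff _).2 fun a ha =>
    Subtype.val_injective ((mem_mtIdeal_map_iff hh (toAdjoint ℚ A) a).1 ha)

/-- If `y = φ ∘ h`, where the Mumford-Tate group of `h` is the whole group, this is the surjection
of that group onto the Mumford-Tate group of `y`. The point `y` is a parameter so that two such
presentations of it can be compared. -/
def mumfordTateLift {h : DeligneHom A} (hh : h.mtIdeal = ⊥) {φ : B →ₐc[ℚ] A} {y : DeligneHom B}
    (e : h.map φ = y) : y.MumfordTate →ₐc[ℚ] A :=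
  quotientLift y.mtIdeal φ fun b => (e ▸ mem_mtIdeal_map_iff hh φ b).1

section

variable {h : DeligneHom A} (hh : h.mtIdeal = ⊥) {φ : B →ₐc[ℚ] A} {y : DeligneHom B}
  (e : h.map φ = y)

@[simp] lemma mumfordTateLift_mk (b : B) :
    mumfordTateLift hh e (Ideal.Quotient.mk y.mtIdeal b) = φ b := rfl

lemma mumfordTateLift_injective : Function.Injective (mumfordTateLift hh e) :=
  quotientLift_injective _ _ fun b => e ▸ mem_mtIdeal_map_iff hh φ b

lemma map_mumfordTateLift : h.map (mumfordTateLift hh e) = y.toMumfordTate := by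
  refine ext_one_tmul fun b => ?_
  obtain ⟨b, rfl⟩ := Ideal.Quotient.mk_surjective b
  rw [map_one_tmul, mumfordTateLift_mk, toMumfordTate_one_tmul_mk, ← e, map_one_tmul]

end

lemma exists_map_eq_of_bijective {h : DeligneHom A} {h' : DeligneHom B} {φ : C →ₐc[ℚ] A}
    {ψ : C →ₐc[ℚ] B} (hψ : Function.Bijective ψ) (e : h.map φ = h'.map ψ) :
    ∃ θ : B →ₐc[ℚ] A, h.map θ = h' := by
  let ψ' := BialgEquiv.ofBijective ψ hψ
  refine ⟨φ.comp (ψ'.symm : B →ₐc[ℚ] C), ?_⟩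
  rw [map_comp, e]
  exact ext_one_tmul fun b => congrArg (fun b => h' (1 ⊗ₜ b)) (ψ'.apply_symm_apply b)

section

variable (h : DeligneHom A) (φ : B →ₐc[ℚ] A)

lemma toMumfordTate_map_mk_comp :
    h.toMumfordTate.map ((Bialgebra.Quotient.mkBialgHom h.mtIdeal).comp φ) = h.map φ := by
  rw [map_comp, map_toMumfordTate]

/-- The homomorphism `M_h → M_{φ ∘ h}` of Mumford-Tate groups induced by a homomorphism `φ` of
groups. -/
def mumfordTateMap : (h.map φ).MumfordTate →ₐc[ℚ] h.MumfordTate :=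
  mumfordTateLift h.mtIdeal_toMumfordTate (h.toMumfordTate_map_mk_comp φ)

lemma mumfordTateMap_injective : Function.Injective (h.mumfordTateMap φ) :=
  mumfordTateLift_injective _ _

lemma toMumfordTate_map_mumfordTateMap :
    h.toMumfordTate.map (h.mumfordTateMap φ) = (h.map φ).toMumfordTate :=
  map_mumfordTateLift _ _

end

end DeligneHom

section HybridHeckeOrbit

open DeligneHom

variable {A : Type v} [CommRing A] [HopfAlgebra ℚ A]

lemma IsConnectedReductive.isDomain {k : Type v} [Field k] {A : Type u} [CommRing A]
    [HopfAlgebra k A] (h : IsConnectedReductive k A) : IsDomain A :=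
  have := h.connected
  Function.Injective.isDomain
    (Algebra.TensorProduct.includeRight : A →ₐ[k] AlgebraicClosure k ⊗[k] A).toRingHom
    (Algebra.TensorProduct.includeRight_injective (algebraMap k (AlgebraicClosure k)).injective)

/-- The condition that defines the hybrid Hecke orbit of `x`: there is a homomorphism
`φ : M^ad → M_{x'}^ad` over `ℚ` with `φ ∘ x^ad = x'^ad`. -/
def AdjointDominates {B : Type u} [CommRing B] [HopfAlgebra ℚ B] (x : DeligneHom A)
    (x' : DeligneHom B) : Prop :=
  ∃ φ : AdjointRing ℚ x'.MumfordTate →ₐc[ℚ] AdjointRing ℚ A, x.ad.map φ = x'.toMumfordTate.ad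

lemma AdjointDominates.map {B C : Type u} [CommRing B] [HopfAlgebra ℚ B] [CommRing C]
    [HopfAlgebra ℚ C] {x : DeligneHom A} {x' : DeligneHom C} (h : AdjointDominates x x')
    (π : B →ₐc[ℚ] C) : AdjointDominates x (x'.map π) := by
  obtain ⟨φ, hφ⟩ := h
  refine ⟨φ.comp (adjointMap _ (x'.mumfordTateMap_injective π)), ?_⟩
  rw [map_comp, hφ, ad_map_adjointMap, toMumfordTate_map_mumfordTateMap]

/-- The Mumford-Tate group of the common image of `x^ad` and `h^ad` in `G₁^ad × G₂^ad` is a quotient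
of `M^ad` as `x` is Hodge generic, and it is `G^ad` by `adjointSubalgebra_le_range`. -/
theorem IsHodgeGeneric.exists_map_eq_ad [IsDomain (AdjointRing ℚ A)] {x : DeligneHom A}
    (hx : IsHodgeGeneric x) {B₁ B₂ E : Type u} [CommRing B₁] [HopfAlgebra ℚ B₁] [CommRing B₂]
    [HopfAlgebra ℚ B₂] [CommRing E] [HopfAlgebra ℚ E] {h : DeligneHom E} (hh : h.mtIdeal = ⊥)
    {p₁ : B₁ →ₐc[ℚ] E} {p₂ : B₂ →ₐc[ℚ] E} (hp : Function.Surjective (bialgLift p₁ p₂))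
    (hp₁ : Function.Injective p₁) (hp₂ : Function.Injective p₂)
    {φ₁ : AdjointRing ℚ B₁ →ₐc[ℚ] AdjointRing ℚ A} (hφ₁ : x.ad.map φ₁ = (h.map p₁).ad)
    {φ₂ : AdjointRing ℚ B₂ →ₐc[ℚ] AdjointRing ℚ A} (hφ₂ : x.ad.map φ₂ = (h.map p₂).ad) :
    ∃ φ : AdjointRing ℚ E →ₐc[ℚ] AdjointRing ℚ A, x.ad.map φ = h.ad := by
  let θ : AdjointRing ℚ B₁ ⊗[ℚ] AdjointRing ℚ B₂ →ₐc[ℚ] AdjointRing ℚ E :=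
    bialgLift (adjointMap p₁ hp₁) (adjointMap p₂ hp₂)
  let y := h.ad.map θ
  have hy : x.ad.map (B := AdjointRing ℚ B₁ ⊗[ℚ] AdjointRing ℚ B₂) (bialgLift φ₁ φ₂) = y :=
    map_bialgLift_eq (hφ₁.trans (ad_map_adjointMap p₁ hp₁ h).symm)
      (hφ₂.trans (ad_map_adjointMap p₂ hp₂ h).symm)
  let j := mumfordTateLift hx hy
  let i : y.MumfordTate →ₐc[ℚ] AdjointRing ℚ E := mumfordTateLift (mtIdeal_ad hh) rfl
  have hi : Function.Injective i := mumfordTateLift_injective _ _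
  have : IsDomain y.MumfordTate :=
    (mumfordTateLift_injective hx hy).isDomain (j : y.MumfordTate →ₐ[ℚ] AdjointRing ℚ A)
  have hrange := adjointSubalgebra_le_range (C := y.MumfordTate) (ι := (toAdjoint ℚ E).comp i) hp
    (Subtype.val_injective.comp hi)
    (fun a ha => ⟨Ideal.Quotient.mk _ (⟨a, ha⟩ ⊗ₜ 1), by simp [i, θ]⟩)
    (fun b hb => ⟨Ideal.Quotient.mk _ (1 ⊗ₜ ⟨b, hb⟩), by simp [i, θ]⟩)
  have hi' : Function.Surjective i := fun f =>
    (hrange f.2).imp fun _ hc => Subtype.val_injective hc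
  exact exists_map_eq_of_bijective (φ := j) ⟨hi, hi'⟩
    ((map_mumfordTateLift hx hy).trans (map_mumfordTateLift (mtIdeal_ad hh) rfl).symm)

section

variable {B A₁ A₂ : Type u} [CommRing B] [HopfAlgebra ℚ B] [CommRing A₁] [HopfAlgebra ℚ A₁]
  [CommRing A₂] [HopfAlgebra ℚ A₂]

lemma bialgLift_mumfordTateMap_surjective {π₁ : A₁ →ₐc[ℚ] B} {π₂ : A₂ →ₐc[ℚ] B}
    (hπ : Function.Surjective (bialgLift π₁ π₂)) (h : DeligneHom B) :
    Function.Surjective (bialgLift (h.mumfordTateMap π₁) (h.mumfordTateMap π₂)) := by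
  let q : A₁ ⊗[ℚ] A₂ →ₐ[ℚ] (h.map π₁).MumfordTate ⊗[ℚ] (h.map π₂).MumfordTate :=
    Algebra.TensorProduct.map (Ideal.Quotient.mkₐ ℚ (h.map π₁).mtIdeal)
      (Ideal.Quotient.mkₐ ℚ (h.map π₂).mtIdeal)
  have hsquare : (bialgLift (h.mumfordTateMap π₁) (h.mumfordTateMap π₂) : _ →ₐ[ℚ] _).comp q =
      (Ideal.Quotient.mkₐ ℚ h.mtIdeal).comp (bialgLift π₁ π₂ : A₁ ⊗[ℚ] A₂ →ₐ[ℚ] B) :=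
    Algebra.TensorProduct.ext' fun _ _ => rfl
  have hcomp := (Ideal.Quotient.mkₐ_surjective ℚ h.mtIdeal).comp hπ
  exact .of_comp (g := q) fun e =>
    (hcomp e).imp fun t ht => (AlgHom.congr_fun hsquare t).trans ht

lemma AdjointDominates.of_components [IsDomain (AdjointRing ℚ A)] {x : DeligneHom A}
    (hx : IsHodgeGeneric x) {π₁ : A₁ →ₐc[ℚ] B} {π₂ : A₂ →ₐc[ℚ] B}
    (hπ : Function.Surjective (bialgLift π₁ π₂)) {x' : DeligneHom B}
    (h₁ : AdjointDominates x (x'.map π₁)) (h₂ : AdjointDominates x (x'.map π₂)) :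
    AdjointDominates x x' := by
  obtain ⟨φ₁, hφ₁⟩ := h₁
  obtain ⟨φ₂, hφ₂⟩ := h₂
  rw [← toMumfordTate_map_mumfordTateMap] at hφ₁ hφ₂
  exact hx.exists_map_eq_ad x'.mtIdeal_toMumfordTate (bialgLift_mumfordTateMap_surjective hπ x')
    (x'.mumfordTateMap_injective π₁) (x'.mumfordTateMap_injective π₂) hφ₁ hφ₂

lemma bialgLift_fst_snd_surjective : Function.Surjective
    (bialgLift (k := ℚ) (B₁ := A₁) (B₂ := A₂) (E := A₁ ⊗[ℚ] A₂) (fst A₁ A₂) (snd A₁ A₂)) := by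
  refine fun t => ⟨t, ?_⟩
  induction t using TensorProduct.induction_on with
  | zero => exact map_zero _
  | tmul a b =>
    change (a ⊗ₜ[ℚ] (1 : A₂)) * ((1 : A₁) ⊗ₜ[ℚ] b) = a ⊗ₜ b
    rw [Algebra.TensorProduct.tmul_mul_tmul, mul_one, one_mul]
  | add s t hs ht => rw [map_add, hs, ht]

end

end HybridHeckeOrbit

end Shimura

end

theorem mainTheorem10_general {A : Type v} {A₁ A₂ : Type u}
    [CommRing A] [HopfAlgebra ℚ A] [IsDomain (Shimura.AdjointRing ℚ A)]
    [CommRing A₁] [HopfAlgebra ℚ A₁] [CommRing A₂] [HopfAlgebra ℚ A₂]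
    (X₁ : Set (Shimura.DeligneHom A₁)) (X₂ : Set (Shimura.DeligneHom A₂))
    {x : Shimura.DeligneHom A} (hgen : Shimura.IsHodgeGeneric x) :
    Shimura.DeligneHom.prodEquiv ''
        Shimura.hybridHeckeOrbit (Shimura.prodDatum X₁ X₂) x =
      Shimura.hybridHeckeOrbit X₁ x ×ˢ Shimura.hybridHeckeOrbit X₂ x := by
  ext p
  obtain ⟨x', rfl⟩ := Shimura.DeligneHom.prodEquiv.surjective p
  rw [Shimura.DeligneHom.prodEquiv.injective.mem_set_image]
  constructor
  · rintro ⟨hX, hdom⟩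
    have hdom : Shimura.AdjointDominates x x' := hdom
    exact ⟨⟨hX.1, hdom.map (Shimura.DeligneHom.fst A₁ A₂)⟩,
      ⟨hX.2, hdom.map (Shimura.DeligneHom.snd A₁ A₂)⟩⟩
  · rintro ⟨⟨hX₁, hdom₁⟩, ⟨hX₂, hdom₂⟩⟩
    exact ⟨⟨hX₁, hX₂⟩, Shimura.AdjointDominates.of_components hgen
      Shimura.bialgLift_fst_snd_surjective hdom₁ hdom₂⟩

theorem mainTheorem10 {A A₁ A₂ : Type u}
    [CommRing A] [HopfAlgebra ℚ A]
    [CommRing A₁] [HopfAlgebra ℚ A₁]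
    [CommRing A₂] [HopfAlgebra ℚ A₂]
    (X_M : Set (Shimura.DeligneHom A)) (hM : Shimura.IsShimuraDatum X_M)
    (X₁ : Set (Shimura.DeligneHom A₁)) (h₁ : Shimura.IsShimuraDatum X₁)
    (X₂ : Set (Shimura.DeligneHom A₂)) (h₂ : Shimura.IsShimuraDatum X₂)
    (x : Shimura.DeligneHom A) (hx : x ∈ X_M) (hgen : Shimura.IsHodgeGeneric x) :
    Shimura.DeligneHom.prodEquiv ''
        Shimura.hybridHeckeOrbit (Shimura.prodDatum X₁ X₂) x =
      Shimura.hybridHeckeOrbit X₁ x ×ˢ Shimura.hybridHeckeOrbit X₂ x := by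
  have := hM.isConnectedReductive.isDomain
  exact mainTheorem10_general X₁ X₂ hgen
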